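/- Let $\mathrm{sat}_M(y)=\max\{-M,\min\{M,y\}\}$ for $M\in(0,\infty)$ and $\mathrm{sat}_{\infty}(y)=y$. Fix design parameters $K_{VC},K_{CC},\mu_d,\mu_q,\Gamma_d,\Gamma_q,\varepsilon,\omega_{pc},\omega_{qc},\overline Q>0$ (real), $\overline P\in(0,+\infty]$ and $\xi_p,\xi_q>1$, setpoints $\omega_0,V_0,P_0,Q_0\in\mathbb R$, droop coefficients $K_P,K_Q\in\mathbb R$, and physical parameters $\Omega=(\omega_b,C_f,L_f,R_f,L,R)\in\mathbb R_{>0}^6$. For $x=(v_{cd},v_{cq},i_{td},i_{tq},i_{gd},i_{gq},q_1,q_2,p_1,p_2)\in\mathbb R^{10}$ put $$p=v_{cd}i_{gd}+v_{cq}i_{gq},\quad q=v_{cq}i_{gd}-v_{cd}i_{gq},\quad \omega=\omega_0+K_P(P_0-p_1),\quad v^r_{cd}=V_0+K_Q(Q_0-q_1),$$ $$i^r_{td}=i_{gd}-C_f\omega v_{cq}-\tfrac{C_fK_Q}{\omega_b}q_2-\tfrac{C_fK_{VC}}{\omega_b}(v_{cd}-v^r_{cd}),\qquad i^r_{tq}=i_{gq}+C_f\omega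 v_{cd}-\tfrac{C_fK_{VC}}{\omega_b}v_{cq},$$ $$W_d=\tfrac12(v_{cd}-v^r_{cd})^2+\tfrac12(i_{td}-i^r_{td})^2,\qquad W_q=\tfrac12v_{cq}^2+\tfrac12(i_{tq}-i^r_{tq})^2,$$ and, for adaptive gains $z_d,z_q\in\mathbb R$, $$u_d=-\Big(K_{CC}+\tfrac{(1+e^{z_d})\omega_b^2}{4\mu_d}(1+i_{gd}^2+v_{cd}^2)\Big)(i_{td}-i^r_{td})-\tfrac{\omega_b}{C_f}(v_{cd}-v^r_{cd}),$$ $$u_q=-\Big(K_{CC}+\tfrac{(1+e^{z_q})\omega_b^2}{4\mu_q}(1+i_{gq}^2+v_{cq}^2)\Big)(i_{tq}-i^r_{tq})-\tfrac{\omega_b}{C_f}v_{cq},$$ $$\begin{aligned}v_{td}=\tfrac{L_f}{\omega_b}\Big[&-2\omega_b\omega(i_{tq}-i_{gq})+\tfrac{\omega_bR_f}{L_f}i_{td}+\omega_b\big(\tfrac1{L_f}+\omega^2C_f\big)v_{cd}+C_fK_Pp_2v_{cq}-K_{VC}(i_{td}-i^r_{td})\\&+\tfrac{C_fK_{VC}^2}{\omega_b}(v_{cd}-v^r_{cd})+\tfrac{2\xi_q\omega_{qc}K_QC_f}{\omega_b}q_2+\tfrac{\omega_{qc}^2K_QC_f}{\omega_b}\big(q_1-\mathrm{sat}_{\overline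 Q}(q)\big)+u_d\Big],\end{aligned}$$ $$\begin{aligned}v_{tq}=\tfrac{L_f}{\omega_b}\Big[&2\omega_b\omega(i_{td}-i_{gd})+\tfrac{\omega_bR_f}{L_f}i_{tq}+\omega_b\big(\tfrac1{L_f}+C_f\omega^2+\tfrac{C_fK_{VC}^2}{\omega_b^2}\big)v_{cq}\\&-C_fK_Pp_2v_{cd}-K_{VC}(i_{tq}-i^r_{tq})+u_q\Big].\end{aligned}$$ For grid voltages $v_{gd},v_{gq}:[0,\infty)\to\mathbb R$ consider the closed-loop system $$\begin{aligned} \dot v_{cd}&=\omega_b\omega v_{cq}+\tfrac{\omega_b}{C_f}(i_{td}-i_{gd}),&\dot v_{cq}&=-\omega_b\omega v_{cd}+\tfrac{\omega_b}{C_f}(i_{tq}-i_{gq}),\\ \dot i_{td}&=\omega_b\omega i_{tq}+\tfrac{\omega_b}{L_f}(v_{td}-v_{cd})-\tfrac{\omega_bR_f}{L_f}i_{td},&\dot i_{tq}&=-\omega_b\omega i_{td}+\tfrac{\omega_b}{L_f}(v_{tq}-v_{cq})-\tfrac{\omega_bR_f}{L_f}i_{tq},\\ \dot i_{gd}&=\omega_b\omega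 i_{gq}+\tfrac{\omega_b}{L}(v_{cd}-v_{gd})-\tfrac{\omega_bR}{L}i_{gd},&\dot i_{gq}&=-\omega_b\omega i_{gd}+\tfrac{\omega_b}{L}(v_{cq}-v_{gq})-\tfrac{\omega_bR}{L}i_{gq},\\ \dot q_1&=q_2,&\dot q_2&=-2\xi_q\omega_{qc}q_2-\omega_{qc}^2\big(q_1-\mathrm{sat}_{\overline Q}(q)\big),\\ \dot p_1&=p_2,&\dot p_2&=-2\xi_p\omega_{pc}p_2-\omega_{pc}^2\big(p_1-\mathrm{sat}_{\overline P}(p)\big),\\ \dot z_d&=\Gamma_de^{-z_d}\max\{W_d-\varepsilon,0\},&\dot z_q&=\Gamma_qe^{-z_q}\max\{W_q-\varepsilon,0\}. \end{aligned}$$ A solution on an interval $[0,T)$, $T\in(0,+\infty]$, is a function $(x,z_d,z_q)$ that is absolutely continuous on every compact subinterval and satisfies these equations for almost every $t\in[0,T)$. Then there is a continuous function $B:\mathbb R^{10}\times\mathbb R\times\mathbb R\times[0,\infty)\times[0,\infty)\to[0,\infty)$, depending only on the parameters fixed above, such that for all $v_{gd},v_{gq}\in L^\infty([0,\infty);\mathbb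 R)$ and every initial state $(x_0,z_{d,0},z_{q,0})\in\mathbb R^{10}\times\mathbb R\times\mathbb R$ the system has a solution $(x,z_d,z_q)$ on $[0,\infty)$ with this initial state; every solution on an interval $[0,T)$, $T\in(0,+\infty]$, with the same initial state coincides with it on $[0,T)$; and, writing $\bar B=B(x_0,z_{d,0},z_{q,0},\|v_{gd}\|_\infty,\|v_{gq}\|_\infty)$ with essential-supremum norms, $$\|x(t)\|\le\bar B\quad\text{for all }t\ge0\quad\text{(Euclidean norm)},$$ while for $\ell\in\{d,q\}$ the gain $z_\ell$ is non-decreasing on $[0,\infty)$, $\lim_{s\to\infty}z_\ell(s)$ exists and is finite, and $$z_{\ell,0}\le z_\ell(t)\le\lim_{s\to\infty}z_\ell(s)\le\bar B\quad\text{for all }t\ge0.$$ -/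

import Mathlib

open MeasureTheory Filter Topology Set
open scoped NNReal ENNReal

namespace GFM

/-- The saturation function with threshold `M ∈ (0, +∞]`; for `M = ⊤` it is the identity. -/
noncomputable def sat (M : EReal) (y : ℝ) : ℝ :=
  if M < (y : EReal) then M.toReal
  else if (y : EReal) < -M then -M.toReal
  else y

/-- The constant physical parameters `Ω = [ω_b, C_f, L_f, R_f, L, R]`. -/
structure PhysParams where
  ωb : ℝ
  Cf : ℝ
  Lf : ℝ
  Rf : ℝ
  L : ℝ
  R : ℝ

/-- `Ω` lies in the open positive orthant of `ℝ⁶`. -/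
structure PhysParams.Pos (Ω : PhysParams) : Prop where
  ωb : 0 < Ω.ωb
  Cf : 0 < Ω.Cf
  Lf : 0 < Ω.Lf
  Rf : 0 < Ω.Rf
  L : 0 < Ω.L
  R : 0 < Ω.R

/-- Design parameters, setpoints and droop coefficients. The reactive-power saturation
threshold `Qbar` is finite, the active-power threshold `Pbar` may be `⊤`. -/
structure DesignParams where
  KVC : ℝ
  KCC : ℝ
  μd : ℝ
  μq : ℝ
  Γd : ℝ
  Γq : ℝ
  ε : ℝ
  ωpc : ℝ
  ωqc : ℝ
  Qbar : ℝ
  Pbar : EReal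
  ξp : ℝ
  ξq : ℝ
  ω₀ : ℝ
  V₀ : ℝ
  P₀ : ℝ
  Q₀ : ℝ
  KP : ℝ
  KQ : ℝ

/-- The conditions on the design parameters; setpoints and droop coefficients are arbitrary. -/
structure DesignParams.Admissible (D : DesignParams) : Prop where
  KVC : 0 < D.KVC
  KCC : 0 < D.KCC
  μd : 0 < D.μd
  μq : 0 < D.μq
  Γd : 0 < D.Γd
  Γq : 0 < D.Γq
  ε : 0 < D.ε
  ωpc : 0 < D.ωpc
  ωqc : 0 < D.ωqc
  Qbar : 0 < D.Qbar
  Pbar : 0 < D.Pbar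
  ξp : 1 < D.ξp
  ξq : 1 < D.ξq

/-- The space of the state `x = [v_cd, v_cq, i_td, i_tq, i_gd, i_gq, q₁, q₂, p₁, p₂]`, with the
Euclidean norm. -/
abbrev X : Type := EuclideanSpace ℝ (Fin 10)

/-- The space of the closed-loop state `(x, z_d, z_q)`. -/
abbrev State : Type := X × ℝ × ℝ

section Coordinates

variable (x : X)

def vcd : ℝ := x 0

def vcq : ℝ := x 1

def itd : ℝ := x 2

def itq : ℝ := x 3

def igd : ℝ := x 4

def igq : ℝ := x 5

def q₁ : ℝ := x 6

def q₂ : ℝ := x 7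

def p₁ : ℝ := x 8

def p₂ : ℝ := x 9

end Coordinates

section Model

variable (Ω : PhysParams) (D : DesignParams) (x : X)

/-- Instantaneous active power at the PCC. -/
def actPower : ℝ := vcd x * igd x + vcq x * igq x

/-- Instantaneous reactive power at the PCC. -/
def reactPower : ℝ := vcq x * igd x - vcd x * igq x

/-- Droop-generated frequency `ω`. -/
def freq : ℝ := D.ω₀ + D.KP * (D.P₀ - p₁ x)

/-- Droop-generated d-axis voltage reference `v_cd^r` (the q-axis reference is `0`). -/
def vcdRef : ℝ := D.V₀ + D.KQ * (D.Q₀ - q₁ x)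

/-- Right-hand side of the equations of the inverter circuit and of the power filters, for
the terminal voltages `(vtd, vtq)` and the grid voltages `(vgd, vgq)`. -/
noncomputable def plant (vtd vtq vgd vgq : ℝ) : X :=
  WithLp.toLp 2 ![
    Ω.ωb * freq D x * vcq x + Ω.ωb / Ω.Cf * (itd x - igd x),
    -(Ω.ωb * freq D x * vcd x) + Ω.ωb / Ω.Cf * (itq x - igq x),
    Ω.ωb * freq D x * itq x + Ω.ωb / Ω.Lf * (vtd - vcd x) - Ω.ωb * Ω.Rf / Ω.Lf * itd x,
    -(Ω.ωb * freq D x * itd x) + Ω.ωb / Ω.Lf * (vtq - vcq x) - Ω.ωb * Ω.Rf / Ω.Lf * itq x,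
    Ω.ωb * freq D x * igq x + Ω.ωb / Ω.L * (vcd x - vgd) - Ω.ωb * Ω.R / Ω.L * igd x,
    -(Ω.ωb * freq D x * igd x) + Ω.ωb / Ω.L * (vcq x - vgq) - Ω.ωb * Ω.R / Ω.L * igq x,
    q₂ x,
    -(2 * D.ξq * D.ωqc * q₂ x) - D.ωqc ^ 2 * (q₁ x - sat D.Qbar (reactPower x)),
    p₂ x,
    -(2 * D.ξp * D.ωpc * p₂ x) - D.ωpc ^ 2 * (p₁ x - sat D.Pbar (actPower x))]

/-- Reference terminal current `i_td^r`. -/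
noncomputable def itdRef : ℝ :=
  igd x - Ω.Cf * freq D x * vcq x - Ω.Cf * D.KQ / Ω.ωb * q₂ x
    - Ω.Cf * D.KVC / Ω.ωb * (vcd x - vcdRef D x)

/-- Reference terminal current `i_tq^r`. -/
noncomputable def itqRef : ℝ :=
  igq x + Ω.Cf * freq D x * vcd x - Ω.Cf * D.KVC / Ω.ωb * vcq x

/-- Auxiliary d-axis input `u_d`. -/
noncomputable def ud (zd : ℝ) : ℝ :=
  -(D.KCC + (1 + Real.exp zd) * Ω.ωb ^ 2 / (4 * D.μd) * (1 + igd x ^ 2 + vcd x ^ 2))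
      * (itd x - itdRef Ω D x)
    - Ω.ωb / Ω.Cf * (vcd x - vcdRef D x)

/-- Auxiliary q-axis input `u_q`. -/
noncomputable def uq (zq : ℝ) : ℝ :=
  -(D.KCC + (1 + Real.exp zq) * Ω.ωb ^ 2 / (4 * D.μq) * (1 + igq x ^ 2 + vcq x ^ 2))
      * (itq x - itqRef Ω D x)
    - Ω.ωb / Ω.Cf * vcq x

/-- The d-axis control law for the terminal voltage `v_td`. -/
noncomputable def vtd (zd : ℝ) : ℝ :=
  Ω.Lf / Ω.ωb * (
    -(2 * Ω.ωb * freq D x * (itq x - igq x)) + Ω.ωb * Ω.Rf / Ω.Lf * itd x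
    + Ω.ωb * (1 / Ω.Lf + freq D x ^ 2 * Ω.Cf) * vcd x + Ω.Cf * D.KP * p₂ x * vcq x
    - D.KVC * (itd x - itdRef Ω D x) + Ω.Cf * D.KVC ^ 2 / Ω.ωb * (vcd x - vcdRef D x)
    + 2 * D.ξq * D.ωqc * D.KQ * Ω.Cf / Ω.ωb * q₂ x
    + D.ωqc ^ 2 * D.KQ * Ω.Cf / Ω.ωb * (q₁ x - sat D.Qbar (reactPower x))
    + ud Ω D x zd)

/-- The q-axis control law for the terminal voltage `v_tq`. -/
noncomputable def vtq (zq : ℝ) : ℝ :=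
  Ω.Lf / Ω.ωb * (
    2 * Ω.ωb * freq D x * (itd x - igd x) + Ω.ωb * Ω.Rf / Ω.Lf * itq x
    + Ω.ωb * (1 / Ω.Lf + Ω.Cf * freq D x ^ 2 + Ω.Cf * D.KVC ^ 2 / Ω.ωb ^ 2) * vcq x
    - Ω.Cf * D.KP * p₂ x * vcd x
    - D.KVC * (itq x - itqRef Ω D x) + uq Ω D x zq)

/-- The energy signal `W_d`. -/
noncomputable def Wd : ℝ :=
  1 / 2 * (vcd x - vcdRef D x) ^ 2 + 1 / 2 * (itd x - itdRef Ω D x) ^ 2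

/-- The energy signal `W_q`. -/
noncomputable def Wq : ℝ :=
  1 / 2 * vcq x ^ 2 + 1 / 2 * (itq x - itqRef Ω D x) ^ 2

end Model

/-- Right-hand side of the closed loop in the state `s = (x, z_d, z_q)`, for the grid voltages
`(vgd, vgq)`. -/
noncomputable def closedLoop (Ω : PhysParams) (D : DesignParams) (vgd vgq : ℝ) (s : State) :
    State :=
  (plant Ω D s.1 (vtd Ω D s.1 s.2.1) (vtq Ω D s.1 s.2.2) vgd vgq,
    D.Γd * Real.exp (-s.2.1) * max (Wd Ω D s.1 - D.ε) 0,
    D.Γq * Real.exp (-s.2.2) * max (Wq Ω D s.1 - D.ε) 0)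

/-- `s` is an absolutely continuous solution, on an interval `I` of times containing `0`, of the
closed loop with grid voltages `vgd, vgq` and initial state `s₀`: it is absolutely continuous on
every compact subinterval of `I` and satisfies the differential equations almost everywhere
on `I`. Only the values of `s` on `I` matter. -/
structure IsSolutionOn (Ω : PhysParams) (D : DesignParams) (vgd vgq : ℝ → ℝ) (s₀ : State)
    (I : Set ℝ) (s : ℝ → State) : Prop where
  init : s 0 = s₀
  absCont : ∀ a ∈ I, ∀ b ∈ I, AbsolutelyContinuousOnInterval s a b
  ode : ∀ᵐ t ∂(volume.restrict I), HasDerivAt s (closedLoop Ω D (vgd t) (vgq t) (s t)) t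

/-- Lebesgue measure on the half-line `[0, ∞)`. -/
noncomputable def halfLine : Measure ℝ := volume.restrict (Ici 0)

/-- The essential supremum norm of a function on `[0, ∞)`. -/
noncomputable def supNorm (v : ℝ → ℝ) : ℝ≥0 := (eLpNorm v ⊤ halfLine).toNNReal

end GFM

/-!
In the error coordinates of the backstepping control law, `W_d` and `W_q` satisfy
`W' ≤ -2κ W + b / (1 + e^z)`: by Young's inequality, the high-gain term of the control law absorbs
the unmatched grid voltage up to a remainder that the gain divides. Hence `W` is bounded, and once
`e^z` exceeds `b / (2κε)` the excess `W - ε` decays exponentially; since `e^z` grows at the rate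
`Γ max(W - ε, 0)`, it then increases only by a bounded amount. The remaining states are bounded in
cascade: the saturated reactive power bounds the reactive filter and with it the reference voltage
and `v_cd`; the grid currents dissipate through the resistance; then the active power bounds the
active filter, the frequency and finally the terminal currents.

These bounds are uniform over all trajectories of the differential inclusion whose velocities
account for every grid voltage of a given size. They therefore exclude finite-time blow-up, and,
being locally uniform in the data, they are dominated by a continuous function of the data.
-/

section AbsoluteContinuity

variable {X Y : Type*} [PseudoMetricSpace X] [PseudoMetricSpace Y] {a b : ℝ}

theorem absolutelyContinuousOnInterval_of_dist_le {f : ℝ → X} {g : ℝ → Y} {C : ℝ}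
    (hf : AbsolutelyContinuousOnInterval f a b)
    (h : ∀ x ∈ uIcc a b, ∀ y ∈ uIcc a b, dist (g x) (g y) ≤ C * dist (f x) (f y)) :
    AbsolutelyContinuousOnInterval g a b := by
  refine squeeze_zero' (.of_forall fun P => by positivity)
    (eventually_inf_principal.2 (.of_forall fun P hP => ?_))
    (by simpa only [mul_zero] using Tendsto.const_mul C hf)
  rw [Finset.mul_sum]
  exact Finset.sum_le_sum fun i hi => h _ (hP.1 i hi).1 _ (hP.1 i hi).2

theorem absolutelyContinuousOnInterval_congr {f g : ℝ → X}
    (hf : AbsolutelyContinuousOnInterval f a b) (h : EqOn f g (uIcc a b)) :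
    AbsolutelyContinuousOnInterval g a b :=
  absolutelyContinuousOnInterval_of_dist_le (C := 1) hf fun x hx y hy => by
    rw [one_mul, h hx, h hy]

theorem absolutelyContinuousOnInterval_comp {E : Type*} [SeminormedAddCommGroup E] {f : ℝ → E}
    {g : E → Y} (hg : LocallyLipschitz g) (hf : AbsolutelyContinuousOnInterval f a b) :
    AbsolutelyContinuousOnInterval (fun t => g (f t)) a b := by
  have hcompact : IsCompact (f '' uIcc a b) := isCompact_uIcc.image_of_continuousOn hf.continuousOn
  obtain ⟨K, hK⟩ := hg.locallyLipschitzOn.exists_lipschitzOnWith_of_compact hcompact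
  exact absolutelyContinuousOnInterval_of_dist_le hf fun x hx y hy =>
    hK.dist_le_mul _ (mem_image_of_mem f hx) _ (mem_image_of_mem f hy)

end AbsoluteContinuity

section DifferentialInequalities

variable {f : ℝ → ℝ} {a b c t₀ t₁ : ℝ}

theorem le_of_ae_deriv_nonpos (hab : a ≤ b) (hf : AbsolutelyContinuousOnInterval f a b)
    (h : ∀ᵐ t ∂volume.restrict (Icc a b), deriv f t ≤ 0) : f b ≤ f a := by
  rw [← sub_nonpos, ← hf.integral_deriv_eq_sub, intervalIntegral.integral_of_le hab]
  exact integral_nonpos_of_ae (ae_restrict_of_ae_restrict_of_subset Ioc_subset_Icc_self h)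

theorem monotoneOn_of_ae_deriv_nonneg {I : Set ℝ} (hI : I.OrdConnected)
    (hf : ∀ a ∈ I, ∀ b ∈ I, AbsolutelyContinuousOnInterval f a b)
    (h : ∀ᵐ t ∂volume.restrict I, 0 ≤ deriv f t) : MonotoneOn f I := by
  intro a ha b hb hab
  refine neg_le_neg_iff.1
    (le_of_ae_deriv_nonpos (f := fun t => -f t) hab (hf a ha b hb).fun_neg ?_)
  filter_upwards [ae_restrict_of_ae_restrict_of_subset (hI.out ha hb) h] with t ht
  rw [deriv.fun_neg]
  exact neg_nonpos.2 ht

theorem ae_restrict_Icc_differentiableAt (hab : a ≤ b)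
    (hf : AbsolutelyContinuousOnInterval f a b) :
    ∀ᵐ t ∂volume.restrict (Icc a b), DifferentiableAt ℝ f t := by
  rw [ae_restrict_iff' measurableSet_Icc, ← uIcc_of_le hab]
  exact hf.ae_differentiableAt

theorem le_mul_exp_of_ae_deriv_le (ht : t₀ ≤ t₁) (hf : AbsolutelyContinuousOnInterval f t₀ t₁)
    (h : ∀ᵐ t ∂volume.restrict (Icc t₀ t₁), deriv f t ≤ c * f t) :
    f t₁ ≤ f t₀ * Real.exp (c * (t₁ - t₀)) := by
  have hanti : Real.exp (-c * (t₁ - t₀)) * f t₁ ≤ Real.exp (-c * (t₀ - t₀)) * f t₀ := by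
    refine le_of_ae_deriv_nonpos (f := fun t => Real.exp (-c * (t - t₀)) * f t) ht
      (.fun_mul (ContDiffOn.absolutelyContinuousOnInterval (by fun_prop)) hf) ?_
    filter_upwards [h, ae_restrict_Icc_differentiableAt ht hf] with t hle hd
    have hexp : HasDerivAt (fun t => Real.exp (-c * (t - t₀)))
        (Real.exp (-c * (t - t₀)) * (-c * 1)) t :=
      (((hasDerivAt_id t).sub_const t₀).const_mul (-c)).exp
    rw [(hexp.fun_mul hd.hasDerivAt).deriv]
    nlinarith [Real.exp_pos (-c * (t - t₀))]
  rw [sub_self, mul_zero, Real.exp_zero, one_mul] at hanti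
  calc f t₁ = Real.exp (-c * (t₁ - t₀)) * f t₁ * Real.exp (c * (t₁ - t₀)) := by
        rw [mul_right_comm, ← Real.exp_add]; simp
    _ ≤ f t₀ * Real.exp (c * (t₁ - t₀)) := by gcongr

theorem le_max_of_ae_deriv_le (ht : t₀ ≤ t₁) (ha : 0 < a)
    (hf : AbsolutelyContinuousOnInterval f t₀ t₁)
    (h : ∀ᵐ t ∂volume.restrict (Icc t₀ t₁), deriv f t ≤ -a * f t + b) :
    f t₁ ≤ max (f t₀) (b / a) := by
  have hdecay : f t₁ - b / a ≤ (f t₀ - b / a) * Real.exp (-a * (t₁ - t₀)) := by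
    refine le_mul_exp_of_ae_deriv_le (f := fun t => f t - b / a) ht
      (absolutelyContinuousOnInterval_of_dist_le (C := 1) hf fun x _ y _ => by simp) ?_
    filter_upwards [h] with t hle
    rw [deriv_sub_const]
    have : -a * (f t - b / a) = -a * f t + b := by field
    exact hle.trans this.ge
  have hexp : Real.exp (-a * (t₁ - t₀)) ≤ 1 := Real.exp_le_one_iff.2 (by nlinarith)
  have hexp_pos := Real.exp_pos (-a * (t₁ - t₀))
  rcases le_total (f t₀) (b / a) with h0 | h0
  · exact le_max_of_le_right (by nlinarith)
  · exact le_max_of_le_left (by nlinarith)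

theorem deriv_max_zero_le {t : ℝ} (hf : ContinuousAt f t)
    (h : deriv f t ≤ -c * f t) :
    deriv (fun τ => max (f τ) 0) t ≤ -c * max (f t) 0 := by
  rcases lt_or_ge 0 (f t) with hpos | hneg
  · have heq : (fun τ => max (f τ) 0) =ᶠ[𝓝 t] f :=
      (hf.eventually_const_lt hpos).mono fun τ hτ => max_eq_left hτ.le
    rwa [heq.deriv_eq, max_eq_left hpos.le]
  · have hmin : IsLocalMin (fun τ => max (f τ) 0) t :=
      .of_forall fun τ => by simp only [max_eq_right hneg, le_max_right]
    simp [hmin.deriv_eq_zero, max_eq_right hneg]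

theorem deriv_norm_le_norm_deriv {E : Type*} [NormedAddCommGroup E] [NormedSpace ℝ E]
    {f : ℝ → E} {t : ℝ} (hf : DifferentiableAt ℝ f t) :
    deriv (fun τ => ‖f τ‖) t ≤ ‖deriv f t‖ := by
  by_cases h : DifferentiableAt ℝ (fun τ => ‖f τ‖) t
  · refine le_of_tendsto_of_tendsto h.hasDerivAt.tendsto_slope
      hf.hasDerivAt.tendsto_slope.norm (.of_forall fun τ => ?_)
    change slope (fun τ => ‖f τ‖) t τ ≤ ‖slope f t τ‖
    rw [slope_def_module, slope_def_module, norm_smul, smul_eq_mul]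
    calc (τ - t)⁻¹ * (‖f τ‖ - ‖f t‖) ≤ ‖(τ - t)⁻¹‖ * |‖f τ‖ - ‖f t‖| :=
          (le_abs_self _).trans (abs_mul _ _).le
      _ ≤ ‖(τ - t)⁻¹‖ * ‖f τ - f t‖ := by gcongr; exact abs_norm_sub_norm_le _ _
  · rw [deriv_zero_of_not_differentiableAt h]
    positivity

end DifferentialInequalities

section Caratheodory

variable {E : Type*} [NormedAddCommGroup E] [NormedSpace ℝ E]

theorem absolutelyContinuousOnInterval_integral {u : ℝ → E} {a b : ℝ}
    (hu : IntervalIntegrable u volume a b) :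
    AbsolutelyContinuousOnInterval (fun t => ∫ τ in a..t, u τ) a b := by
  refine absolutelyContinuousOnInterval_of_dist_le (C := 1)
    (hu.norm.absolutelyContinuousOnInterval_intervalIntegral left_mem_uIcc) fun x hx y hy => ?_
  have hint : ∀ {z}, z ∈ uIcc a b → IntervalIntegrable u volume a z := fun hz =>
    hu.mono_set (uIcc_subset_uIcc_left hz)
  rw [one_mul, dist_eq_norm, dist_eq_norm, intervalIntegral.integral_interval_sub_left (hint hx)
    (hint hy), intervalIntegral.integral_interval_sub_left (hint hx).norm (hint hy).norm]
  exact intervalIntegral.norm_integral_le_abs_integral_norm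

/-- `s` is an absolutely continuous solution of `s' = F(s) + u(t)` on the set of times `I`. The
input `u` is only required to make sense almost everywhere, as in Carathéodory's theory. -/
structure IsCaratheodorySolutionOn (F : E → E) (u : ℝ → E) (I : Set ℝ) (s : ℝ → E) : Prop where
  absCont : ∀ a ∈ I, ∀ b ∈ I, AbsolutelyContinuousOnInterval s a b
  ode : ∀ᵐ t ∂volume.restrict I, HasDerivAt s (F (s t) + u t) t

namespace IsCaratheodorySolutionOn

variable {F G : E → E} {u s s₁ s₂ : ℝ → E} {I J : Set ℝ} {T : ℝ}

theorem mono (h : IsCaratheodorySolutionOn F u I s) (hJ : J ⊆ I) :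
    IsCaratheodorySolutionOn F u J s :=
  ⟨fun a ha b hb => h.absCont a (hJ ha) b (hJ hb), ae_restrict_of_ae_restrict_of_subset hJ h.ode⟩

theorem absCont_zero (h : IsCaratheodorySolutionOn F u (Icc 0 T) s) (hT : 0 ≤ T) :
    AbsolutelyContinuousOnInterval s 0 T :=
  h.absCont 0 (left_mem_Icc.2 hT) T (right_mem_Icc.2 hT)

theorem continuousOn (h : IsCaratheodorySolutionOn F u (Icc 0 T) s) (hT : 0 ≤ T) :
    ContinuousOn s (Icc 0 T) :=
  uIcc_of_le hT ▸ (h.absCont_zero hT).continuousOn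

theorem of_eqOn_Ico (h : IsCaratheodorySolutionOn G u (Icc 0 T) s)
    (hGF : ∀ t ∈ Ico 0 T, G (s t) = F (s t)) : IsCaratheodorySolutionOn F u (Icc 0 T) s := by
  refine ⟨h.absCont, ?_⟩
  have hode := h.ode
  rw [← Measure.restrict_congr_set Ico_ae_eq_Icc] at hode ⊢
  filter_upwards [hode, ae_restrict_mem measurableSet_Ico] with t hd ht
  exact hGF t ht ▸ hd

theorem apply_right_eq (hF : LocallyLipschitz F) (hT : 0 ≤ T)
    (h₁ : IsCaratheodorySolutionOn F u (Icc 0 T) s₁)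
    (h₂ : IsCaratheodorySolutionOn F u (Icc 0 T) s₂) (h₀ : s₁ 0 = s₂ 0) : s₁ T = s₂ T := by
  have hcompact : IsCompact (s₁ '' Icc 0 T ∪ s₂ '' Icc 0 T) :=
    (isCompact_Icc.image_of_continuousOn (h₁.continuousOn hT)).union
      (isCompact_Icc.image_of_continuousOn (h₂.continuousOn hT))
  obtain ⟨K, hK⟩ := hF.locallyLipschitzOn.exists_lipschitzOnWith_of_compact hcompact
  have hdist : AbsolutelyContinuousOnInterval (fun t => ‖s₁ t - s₂ t‖) 0 T :=
    absolutelyContinuousOnInterval_comp lipschitzWith_one_norm.locallyLipschitz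
      ((h₁.absCont_zero hT).fun_sub (h₂.absCont_zero hT))
  have hgrowth := le_mul_exp_of_ae_deriv_le (c := K) hT hdist (by
    filter_upwards [h₁.ode, h₂.ode, ae_restrict_mem measurableSet_Icc] with t hd₁ hd₂ ht
    have hd := hd₁.fun_sub hd₂
    calc deriv (fun τ => ‖s₁ τ - s₂ τ‖) t ≤ ‖deriv (fun τ => s₁ τ - s₂ τ) t‖ :=
          deriv_norm_le_norm_deriv hd.differentiableAt
      _ = ‖F (s₁ t) - F (s₂ t)‖ := by rw [hd.deriv, add_sub_add_right_eq_sub]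
      _ ≤ K * ‖s₁ t - s₂ t‖ := hK.norm_sub_le (.inl (mem_image_of_mem _ ht))
          (.inr (mem_image_of_mem _ ht)))
  rw [h₀, sub_self, norm_zero, zero_mul] at hgrowth
  exact sub_eq_zero.1 (norm_le_zero_iff.1 hgrowth)

theorem exists_Ici (hF : LocallyLipschitz F) {S : ℕ → ℝ → E} {s₀ : E} (hS₀ : ∀ n, S n 0 = s₀)
    (hS : ∀ n : ℕ, IsCaratheodorySolutionOn F u (Icc 0 n) (S n)) :
    ∃ s, s 0 = s₀ ∧ IsCaratheodorySolutionOn F u (Ici 0) s := by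
  let s : ℝ → E := fun t => S (⌊t⌋₊ + 1) t
  have hs : ∀ n : ℕ, EqOn (S n) s (Icc 0 n) := fun n t ht => by
    have hle : t ≤ ((⌊t⌋₊ + 1 : ℕ) : ℝ) := by push_cast; exact (Nat.lt_floor_add_one t).le
    exact apply_right_eq (s₂ := S (⌊t⌋₊ + 1)) hF ht.1 ((hS n).mono (Icc_subset_Icc le_rfl ht.2))
      ((hS _).mono (Icc_subset_Icc le_rfl hle)) (by rw [hS₀, hS₀])
  refine ⟨s, by simp [s, hS₀], fun a ha b hb => ?_, ?_⟩
  · obtain ⟨n, hn⟩ := exists_nat_ge (max a b)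
    have ha' : a ∈ Icc 0 (n : ℝ) := ⟨ha, (le_max_left _ _).trans hn⟩
    have hb' : b ∈ Icc 0 (n : ℝ) := ⟨hb, (le_max_right _ _).trans hn⟩
    exact absolutelyContinuousOnInterval_congr ((hS n).absCont a ha' b hb')
      ((hs n).mono (uIcc_subset_Icc ha' hb'))
  · have hode : ∀ᵐ t : ℝ, ∀ n : ℕ, t ∈ Icc 0 (n : ℝ) → HasDerivAt (S n) (F (S n t) + u t) t :=
      ae_all_iff.2 fun n => (ae_restrict_iff' measurableSet_Icc).1 (hS n).ode
    rw [← Measure.restrict_congr_set Ioi_ae_eq_Ici, ae_restrict_iff' measurableSet_Ioi]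
    filter_upwards [hode] with t hd ht
    obtain ⟨n, hn⟩ := exists_nat_gt t
    have hmem : t ∈ Icc 0 (n : ℝ) := ⟨(mem_Ioi.1 ht).le, hn.le⟩
    rw [← hs n hmem]
    refine (hd n hmem).congr_of_eventuallyEq ?_
    filter_upwards [Icc_mem_nhds ht hn] with τ hτ using (hs n hτ).symm

end IsCaratheodorySolutionOn

variable [FiniteDimensional ℝ E] {F : E → E} {U u : ℝ → E} {s₀ : E} {T : ℝ}

theorem exists_hasDerivWithinAt_add_of_bounded (hF : LocallyLipschitz F) {L : ℝ≥0}
    (hL : ∀ x, ‖F x‖ ≤ L) (hT : 0 ≤ T) (hU : ContinuousOn U (Icc 0 T)) (s₀ : E) :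
    ∃ y : ℝ → E, y 0 = s₀ ∧ ∀ t ∈ Icc 0 T, HasDerivWithinAt y (F (y t + U t)) (Icc 0 T) t := by
  have : ProperSpace E := FiniteDimensional.proper ℝ E
  obtain ⟨b, hb⟩ := isCompact_Icc.exists_bound_of_continuousOn hU
  let a : ℝ≥0 := L * ⟨T, hT⟩
  obtain ⟨K, hK⟩ := hF.locallyLipschitzOn.exists_lipschitzOnWith_of_compact
    (isCompact_closedBall s₀ (a + b))
  have hPL : IsPicardLindelof (fun t y => F (y + U t)) (tmin := 0) (tmax := T)
      ⟨0, left_mem_Icc.2 hT⟩ s₀ a 0 L K :=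
    { lipschitzOnWith := fun t ht => by
        rw [← mul_one K]
        refine hK.comp (g := F) (f := (· + U t))
          (.of_dist_le_mul fun x _ y _ => by simp) fun y hy => ?_
        rw [Metric.mem_closedBall, dist_eq_norm] at hy ⊢
        rw [add_sub_right_comm]
        exact (norm_add_le _ _).trans (add_le_add hy (hb t ht))
      continuousOn := fun x _ => hF.continuous.comp_continuousOn (continuousOn_const.add hU)
      norm_le := fun t _ x _ => hL _
      mul_max_le := by
        simp only [sub_zero, sub_self, max_eq_left hT, NNReal.coe_zero]
        rfl }
  exact hPL.exists_eq_forall_mem_Icc_hasDerivWithinAt₀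

theorem exists_isCaratheodorySolutionOn_Icc_of_bounded (hF : LocallyLipschitz F) {L : ℝ≥0}
    (hL : ∀ x, ‖F x‖ ≤ L) (hT : 0 ≤ T) (hu : IntervalIntegrable u volume 0 T) (s₀ : E) :
    ∃ s, s 0 = s₀ ∧ IsCaratheodorySolutionOn F u (Icc 0 T) s := by
  have : CompleteSpace E := FiniteDimensional.complete ℝ E
  have hIcc : uIcc 0 T = Icc 0 T := uIcc_of_le hT
  let U : ℝ → E := fun t => ∫ τ in 0..t, u τ
  have hU := absolutelyContinuousOnInterval_integral hu
  obtain ⟨y, hy₀, hy⟩ :=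
    exists_hasDerivWithinAt_add_of_bounded hF hL hT (hIcc ▸ hU.continuousOn) s₀
  refine ⟨fun t => y t + U t, by simp [U, hy₀], fun c hc d hd => ?_, ?_⟩
  · have hlip : LipschitzOnWith L y (Icc 0 T) :=
      (convex_Icc 0 T).lipschitzOnWith_of_nnnorm_hasDerivWithin_le hy fun t _ => hL _
    have hcd : uIcc c d ⊆ Icc 0 T := uIcc_subset_Icc hc hd
    exact (hlip.mono hcd).absolutelyContinuousOnInterval.fun_add (hU.mono (hIcc ▸ hcd))
  · rw [← Measure.restrict_congr_set Ioo_ae_eq_Icc, ae_restrict_iff' measurableSet_Ioo]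
    filter_upwards [hu.ae_hasDerivAt_integral] with t hd ht
    have htT := Ioo_subset_Icc_self ht
    exact ((hy t htT).hasDerivAt (Icc_mem_nhds ht.1 ht.2)).add
      (hd (hIcc ▸ htT) 0 left_mem_uIcc)

theorem exists_bounded_locallyLipschitz_eqOn_closedBall (hF : LocallyLipschitz F) (R : ℝ) :
    ∃ G : E → E, LocallyLipschitz G ∧ (∃ L : ℝ≥0, ∀ x, ‖G x‖ ≤ L) ∧
      EqOn G F (Metric.closedBall 0 R) := by
  have : ProperSpace E := FiniteDimensional.proper ℝ E
  let χ : ContDiffBump (0 : E) := ⟨|R| + 1, |R| + 2, by positivity, by linarith⟩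
  obtain ⟨b, hb⟩ := (isCompact_closedBall (0 : E) (|R| + 2)).exists_bound_of_continuousOn
    hF.continuous.continuousOn
  refine ⟨fun x => χ x • F x, ?_, ⟨b.toNNReal, fun x => ?_⟩, fun x hx => ?_⟩
  · have hsmul : LocallyLipschitz fun p : ℝ × E => p.1 • p.2 :=
      (contDiff_fst.smul contDiff_snd : ContDiff ℝ 1 fun p : ℝ × E => p.1 • p.2).locallyLipschitz
    exact hsmul.comp ((χ.contDiff (n := 1)).locallyLipschitz.prodMk hF)
  · rcases le_total (dist x 0) (|R| + 2) with h | h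
    · rw [norm_smul, Real.norm_eq_abs, abs_of_nonneg χ.nonneg]
      exact (mul_le_of_le_one_left (norm_nonneg _) χ.le_one).trans
        ((hb x h).trans (Real.le_coe_toNNReal b))
    · simp [χ.zero_of_le_dist h]
  · have hχ : χ x = 1 := χ.one_of_mem_closedBall (Metric.closedBall_subset_closedBall
      (show R ≤ |R| + 1 by linarith [le_abs_self R]) hx)
    simp [hχ]

theorem exists_isCaratheodorySolutionOn_Icc (hF : LocallyLipschitz F) (hT : 0 ≤ T)
    (hu : IntervalIntegrable u volume 0 T) {C : ℝ}
    (hC : ∀ τ ∈ Icc 0 T, ∀ s, s 0 = s₀ → IsCaratheodorySolutionOn F u (Icc 0 τ) s → ‖s τ‖ ≤ C) :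
    ∃ s, s 0 = s₀ ∧ IsCaratheodorySolutionOn F u (Icc 0 T) s := by
  obtain ⟨G, hG, ⟨L, hL⟩, hGF⟩ := exists_bounded_locallyLipschitz_eqOn_closedBall hF (C + 1)
  obtain ⟨s, hs₀, hs⟩ := exists_isCaratheodorySolutionOn_Icc_of_bounded hG hL hT hu s₀
  have hsol : ∀ τ ∈ Icc 0 T, (∀ t ∈ Ico 0 τ, ‖s t‖ < C + 1) →
      IsCaratheodorySolutionOn F u (Icc 0 τ) s := fun τ hτ hlt =>
    (hs.mono (Icc_subset_Icc le_rfl hτ.2)).of_eqOn_Ico fun t ht =>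
      hGF (mem_closedBall_zero_iff.2 (hlt t ht).le)
  refine ⟨s, hs₀, hsol T (right_mem_Icc.2 hT) ?_⟩
  by_contra! hexit
  have hcompact : IsCompact (Icc 0 T ∩ (fun t => ‖s t‖) ⁻¹' Ici (C + 1)) :=
    isCompact_Icc.of_isClosed_subset
      ((hs.continuousOn hT).norm.preimage_isClosed_of_isClosed isClosed_Icc isClosed_Ici)
      inter_subset_left
  obtain ⟨τ, ⟨hτ, hCτ⟩, hmin⟩ := hcompact.exists_isLeast
    (hexit.imp fun t ht => ⟨Ico_subset_Icc_self ht.1, ht.2⟩)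
  have hlt : ∀ t ∈ Ico 0 τ, ‖s t‖ < C + 1 := fun t ht => by
    by_contra! hge
    exact (hmin ⟨⟨ht.1, ht.2.le.trans hτ.2⟩, hge⟩).not_gt ht.2
  have hge : C + 1 ≤ ‖s τ‖ := hCτ
  linarith [hC τ hτ s hs₀ (hsol τ hτ hlt)]

-- An a priori bound rules out blow-up in finite time.
theorem exists_isCaratheodorySolutionOn_Ici (hF : LocallyLipschitz F)
    (hu : LocallyIntegrableOn u (Ici 0)) {C : ℝ}
    (hC : ∀ T, 0 ≤ T → ∀ s, s 0 = s₀ → IsCaratheodorySolutionOn F u (Icc 0 T) s → ‖s T‖ ≤ C) :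
    ∃ s, s 0 = s₀ ∧ IsCaratheodorySolutionOn F u (Ici 0) s := by
  have hint : ∀ T, 0 ≤ T → IntervalIntegrable u volume 0 T := fun T hT =>
    (intervalIntegrable_iff_integrableOn_Icc_of_le hT).2
      (hu.integrableOn_compact_subset Icc_subset_Ici_self isCompact_Icc)
  choose S hS₀ hS using fun n : ℕ => exists_isCaratheodorySolutionOn_Icc (T := n) hF n.cast_nonneg
    (hint n n.cast_nonneg) fun τ hτ => hC τ hτ.1
  exact IsCaratheodorySolutionOn.exists_Ici hF hS₀ hS

end Caratheodory

section LocallyLipschitz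

attribute [fun_prop] LocallyLipschitz LocallyLipschitz.id LocallyLipschitz.const
  LocallyLipschitz.comp LocallyLipschitz.prodMk LocallyLipschitz.max_const

variable {α : Type*} [PseudoMetricSpace α] {f g : α → ℝ}

@[fun_prop]
theorem locallyLipschitz_mul (hf : LocallyLipschitz f) (hg : LocallyLipschitz g) :
    LocallyLipschitz fun x => f x * g x :=
  (contDiff_fst.mul contDiff_snd :
    ContDiff ℝ 1 fun p : ℝ × ℝ => p.1 * p.2).locallyLipschitz.comp (hf.prodMk hg)

@[fun_prop]
theorem locallyLipschitz_add (hf : LocallyLipschitz f) (hg : LocallyLipschitz g) :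
    LocallyLipschitz fun x => f x + g x :=
  (contDiff_fst.add contDiff_snd :
    ContDiff ℝ 1 fun p : ℝ × ℝ => p.1 + p.2).locallyLipschitz.comp (hf.prodMk hg)

@[fun_prop]
theorem locallyLipschitz_neg (hf : LocallyLipschitz f) : LocallyLipschitz fun x => -f x :=
  (contDiff_neg (𝕜 := ℝ) (n := 1)).locallyLipschitz.comp hf

@[fun_prop]
theorem locallyLipschitz_sub (hf : LocallyLipschitz f) (hg : LocallyLipschitz g) :
    LocallyLipschitz fun x => f x - g x := by
  simpa only [sub_eq_add_neg] using locallyLipschitz_add hf (locallyLipschitz_neg hg)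

@[fun_prop]
theorem locallyLipschitz_pow (hf : LocallyLipschitz f) (n : ℕ) :
    LocallyLipschitz fun x => f x ^ n :=
  (contDiff_id.pow n : ContDiff ℝ 1 fun y : ℝ => y ^ n).locallyLipschitz.comp hf

@[fun_prop]
theorem locallyLipschitz_exp (hf : LocallyLipschitz f) :
    LocallyLipschitz fun x => Real.exp (f x) :=
  (Real.contDiff_exp (n := 1)).locallyLipschitz.comp hf

theorem locallyLipschitz_pi {ι : Type*} [Fintype ι] {β : ι → Type*} [∀ i, PseudoMetricSpace (β i)]
    {f : α → ∀ i, β i} (hf : ∀ i, LocallyLipschitz fun x => f x i) : LocallyLipschitz f := by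
  intro x
  choose K t ht hK using fun i => hf i x
  refine ⟨Finset.univ.sup K, ⋂ i, t i, iInter_mem.2 ht, fun y hy z hz => ?_⟩
  refine edist_pi_le_iff.2 fun i => (hK i (mem_iInter.1 hy i) (mem_iInter.1 hz i)).trans ?_
  gcongr
  exact Finset.le_sup (Finset.mem_univ i)

end LocallyLipschitz

section BoundedSignals

open Asymptotics

variable {α : Type*} {S : Set α} {f g : α → ℝ}

theorem isBigO_one_principal_iff {F : Type*} [Norm F] {f : α → F} :
    f =O[𝓟 S] (1 : α → ℝ) ↔ ∃ C, ∀ x ∈ S, ‖f x‖ ≤ C := by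
  simp [isBigO_principal]

theorem isBigO_one_mul (hf : f =O[𝓟 S] (1 : α → ℝ)) (hg : g =O[𝓟 S] (1 : α → ℝ)) :
    (fun x => f x * g x) =O[𝓟 S] (1 : α → ℝ) :=
  (hf.mul hg).congr_right fun _ => mul_one 1

theorem isBigO_one_const (c : ℝ) : (fun _ => c) =O[𝓟 S] (1 : α → ℝ) :=
  isBigO_const_const c one_ne_zero _

theorem isBigO_one_of_sq_le {V : α → ℝ} {c : ℝ} (hV : V =O[𝓟 S] (1 : α → ℝ))
    (h : ∀ x, f x ^ 2 ≤ c * V x) : f =O[𝓟 S] (1 : α → ℝ) := by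
  refine IsBigO.of_pow two_ne_zero ?_
  rw [one_pow]
  refine IsBigO.trans (.of_bound |c| (.of_forall fun x => ?_)) hV
  rw [Pi.pow_apply, Real.norm_of_nonneg (sq_nonneg _), Real.norm_eq_abs, ← abs_mul]
  exact (h x).trans (le_abs_self _)

end BoundedSignals

section DifferentialInclusion

open Asymptotics

variable {E : Type*} [NormedAddCommGroup E] [NormedSpace ℝ E]

/-- An absolutely continuous solution on `[0, T]` of the differential inclusion `s' ∈ 𝒱(s)` that
starts in `K`. A control system with bounded disturbances becomes an inclusion when `𝒱 x` collects
its velocities at `x`, so estimates on trajectories are automatically uniform in the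
disturbance. -/
structure IsTrajectory (𝒱 : E → Set E) (K : Set E) (T : ℝ) (s : ℝ → E) : Prop where
  nonneg : 0 ≤ T
  init : s 0 ∈ K
  absCont : AbsolutelyContinuousOnInterval s 0 T
  ode : ∀ᵐ t ∂volume.restrict (Icc 0 T), ∃ v ∈ 𝒱 (s t), HasDerivAt s v t

/-- The states reached from `K` along the inclusion `s' ∈ 𝒱(s)`. -/
def reachableSet (𝒱 : E → Set E) (K : Set E) : Set E :=
  {x | ∃ T s, IsTrajectory 𝒱 K T s ∧ s T = x}

/-- The signal `f` is bounded along the trajectories of `s' ∈ 𝒱(s)` from `K`, uniformly in the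
trajectory. Phrased with `=O` so that the calculus of `IsBigO` applies. -/
abbrev IsBoundedAlong {F : Type*} [Norm F] (𝒱 : E → Set E) (K : Set E) (f : E → F) : Prop :=
  f =O[𝓟 (reachableSet 𝒱 K)] (1 : E → ℝ)

/-- At time `t` the curve `s` is in a reachable state and moves with one of its velocities. -/
def FollowsAt (𝒱 : E → Set E) (K : Set E) (s : ℝ → E) (t : ℝ) : Prop :=
  s t ∈ reachableSet 𝒱 K ∧ ∃ v ∈ 𝒱 (s t), HasDerivAt s v t

variable {𝒱 : E → Set E} {K : Set E} {s : ℝ → E} {T t : ℝ}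

namespace IsTrajectory

theorem restrict (h : IsTrajectory 𝒱 K T s) (ht : t ∈ Icc 0 T) : IsTrajectory 𝒱 K t s where
  nonneg := ht.1
  init := h.init
  absCont := h.absCont.mono (uIcc_subset_uIcc_left (Icc_subset_uIcc ht))
  ode := ae_restrict_of_ae_restrict_of_subset (Icc_subset_Icc le_rfl ht.2) h.ode

theorem ae_followsAt (h : IsTrajectory 𝒱 K T s) :
    ∀ᵐ t ∂volume.restrict (Icc 0 T), FollowsAt 𝒱 K s t := by
  filter_upwards [h.ode, ae_restrict_mem measurableSet_Icc] with t hd ht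
  exact ⟨⟨t, s, h.restrict ht, rfl⟩, hd⟩

theorem absCont_comp (h : IsTrajectory 𝒱 K T s) {V : E → ℝ} (hV : LocallyLipschitz V) :
    AbsolutelyContinuousOnInterval (fun t => V (s t)) 0 T :=
  absolutelyContinuousOnInterval_comp hV h.absCont

end IsTrajectory

theorem reachableSet_mono {𝒱' : E → Set E} {K' : Set E} (h𝒱 : ∀ x, 𝒱 x ⊆ 𝒱' x) (hK : K ⊆ K') :
    reachableSet 𝒱 K ⊆ reachableSet 𝒱' K' := by
  rintro _ ⟨T, s, hs, rfl⟩
  exact ⟨T, s, ⟨hs.nonneg, hK hs.init, hs.absCont,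
    hs.ode.mono fun t ⟨v, hv, hd⟩ => ⟨v, h𝒱 _ hv, hd⟩⟩, rfl⟩

theorem isBoundedAlong_of_deriv_le (hK : IsCompact K) {V : E → ℝ} (hV : LocallyLipschitz V)
    (hV₀ : ∀ x, 0 ≤ V x) {κ b : ℝ} (hκ : 0 < κ)
    (h : ∀ s t, FollowsAt 𝒱 K s t → deriv (fun τ => V (s τ)) t ≤ -κ * V (s t) + b) :
    IsBoundedAlong 𝒱 K V := by
  obtain ⟨C, hC⟩ := hK.exists_bound_of_continuousOn hV.continuous.continuousOn
  refine isBigO_one_principal_iff.2 ⟨max C (b / κ), ?_⟩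
  rintro _ ⟨T, s, hs, rfl⟩
  rw [Real.norm_of_nonneg (hV₀ _)]
  exact (le_max_of_ae_deriv_le hs.nonneg hκ (hs.absCont_comp hV)
    (hs.ae_followsAt.mono fun t => h s t)).trans
    (max_le_max_right _ ((le_abs_self _).trans (hC _ hs.init)))

end DifferentialInclusion

section SecondOrderFilter

theorem mul_le_mul_sq_add_sq_div {k : ℝ} (hk : 0 < k) (a b : ℝ) :
    a * b ≤ k * a ^ 2 + b ^ 2 / (4 * k) := by
  have hsq : k * a ^ 2 + b ^ 2 / (4 * k) - a * b = (2 * k * a - b) ^ 2 / (4 * k) := by field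
  have : 0 ≤ (2 * k * a - b) ^ 2 / (4 * k) := by positivity
  linarith

/-- A strict Lyapunov function of the second-order filter `x₁' = x₂`,
`x₂' = -2ax₂ - ω²(x₁ - u)`. The cross term in `x₂ + a x₁` makes it decay at a rate proportional to
its own value, which the energy `x₂² + ω²x₁²` does not. -/
noncomputable def filterEnergy (a ω x₁ x₂ : ℝ) : ℝ :=
  1 / 2 * (x₂ + a * x₁) ^ 2 + 1 / 2 * (ω ^ 2 + a ^ 2) * x₁ ^ 2

theorem filterEnergy_nonneg (a ω x₁ x₂ : ℝ) : 0 ≤ filterEnergy a ω x₁ x₂ := by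
  unfold filterEnergy
  positivity

theorem deriv_filterEnergy {a ω u t : ℝ} {x₁ x₂ : ℝ → ℝ} (h₁ : HasDerivAt x₁ (x₂ t) t)
    (h₂ : HasDerivAt x₂ (-(2 * a * x₂ t) - ω ^ 2 * (x₁ t - u)) t) :
    deriv (fun τ => filterEnergy a ω (x₁ τ) (x₂ τ)) t
      = -a * x₂ t ^ 2 - a * ω ^ 2 * x₁ t ^ 2 + (x₂ t + a * x₁ t) * (ω ^ 2 * u) := by
  have h := (((h₂.fun_add (h₁.const_mul a)).fun_pow 2).const_mul (1 / 2)).fun_add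
    ((h₁.fun_pow 2).const_mul (1 / 2 * (ω ^ 2 + a ^ 2)))
  exact h.deriv.trans (by ring)

theorem filterEnergy_dissipation_le {a ω κ u M x₁ x₂ : ℝ} (hκ : 0 < κ) (hκa : 2 * κ ≤ a)
    (hκω : κ * (ω ^ 2 + 3 * a ^ 2) ≤ a * ω ^ 2) (hu : |u| ≤ M) :
    -a * x₂ ^ 2 - a * ω ^ 2 * x₁ ^ 2 + (x₂ + a * x₁) * (ω ^ 2 * u)
      ≤ -κ * filterEnergy a ω x₁ x₂ + (ω ^ 2 * M) ^ 2 / (2 * κ) := by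
  have hyoung : (x₂ + a * x₁) * (ω ^ 2 * u)
      ≤ κ / 2 * (x₂ + a * x₁) ^ 2 + (ω ^ 2 * M) ^ 2 / (2 * κ) := by
    refine (mul_le_mul_sq_add_sq_div (half_pos hκ) _ _).trans ?_
    rw [show 4 * (κ / 2) = 2 * κ by ring, mul_pow, mul_pow]
    gcongr _ + _ * ?_ / _
    exact sq_le_sq.2 (hu.trans (le_abs_self M))
  unfold filterEnergy
  nlinarith [mul_nonneg hκ.le (sq_nonneg (x₂ - a * x₁)), mul_nonneg hκ.le (sq_nonneg (ω * x₁)),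
    mul_nonneg hκ.le (sq_nonneg (a * x₁)),
    mul_le_mul_of_nonneg_right hκa (sq_nonneg x₂), mul_le_mul_of_nonneg_right hκω (sq_nonneg x₁)]

variable {E : Type*} [NormedAddCommGroup E] [NormedSpace ℝ E] {𝒱 : E → Set E} {K : Set E}

theorem isBoundedAlong_secondOrderFilter (hK : IsCompact K) {x₁ x₂ u : E → ℝ} {ξ ω : ℝ}
    (hx₁ : LocallyLipschitz x₁) (hx₂ : LocallyLipschitz x₂) (hξ : 0 < ξ) (hω : 0 < ω)
    (h₁ : ∀ s t, FollowsAt 𝒱 K s t → HasDerivAt (fun τ => x₁ (s τ)) (x₂ (s t)) t)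
    (h₂ : ∀ s t, FollowsAt 𝒱 K s t → HasDerivAt (fun τ => x₂ (s τ))
      (-(2 * ξ * ω * x₂ (s t)) - ω ^ 2 * (x₁ (s t) - u (s t))) t)
    (hu : IsBoundedAlong 𝒱 K u) :
    IsBoundedAlong 𝒱 K x₁ ∧ IsBoundedAlong 𝒱 K x₂ := by
  obtain ⟨M, hM⟩ := isBigO_one_principal_iff.1 hu
  let a : ℝ := ξ * ω
  let κ : ℝ := a * ω ^ 2 / (2 * (ω ^ 2 + 3 * a ^ 2))
  have ha : 0 < a := by positivity
  have hκ : 0 < κ := by positivity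
  have hκω : κ * (ω ^ 2 + 3 * a ^ 2) = a * ω ^ 2 / 2 := by simp only [κ]; field
  have hκa : 2 * κ ≤ a := by nlinarith [mul_pos hκ (sq_pos_of_pos ha), sq_pos_of_pos hω]
  have hV : IsBoundedAlong 𝒱 K (fun x => filterEnergy a ω (x₁ x) (x₂ x)) := by
    refine isBoundedAlong_of_deriv_le (b := (ω ^ 2 * M) ^ 2 / (2 * κ)) hK ?_
      (fun x => filterEnergy_nonneg _ _ _ _) hκ fun s t h => ?_
    · unfold filterEnergy
      fun_prop
    · rw [deriv_filterEnergy (h₁ s t h) (by simpa only [a, mul_assoc] using h₂ s t h)]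
      refine filterEnergy_dissipation_le hκ hκa (hκω.trans_le ?_) (hM _ h.1)
      exact half_le_self (by positivity)
  have hx₁O : IsBoundedAlong 𝒱 K x₁ :=
    isBigO_one_of_sq_le hV (c := 2 / ω ^ 2) fun x => by
      rw [div_mul_eq_mul_div, le_div_iff₀ (by positivity), filterEnergy]
      nlinarith [sq_nonneg (x₂ x + a * x₁ x), sq_nonneg (a * x₁ x)]
  have hw : IsBoundedAlong 𝒱 K (fun x => x₂ x + a * x₁ x) :=
    isBigO_one_of_sq_le hV (c := 2) fun x => by
      rw [filterEnergy]
      nlinarith [sq_nonneg (ω * x₁ x), sq_nonneg (a * x₁ x)]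
  exact ⟨hx₁O, by simpa using hw.sub (hx₁O.const_mul_left a)⟩

end SecondOrderFilter

section AdaptiveGain

variable {W g : ℝ → ℝ} {T κ b Γ ε C t₀ t₁ : ℝ}

theorem le_add_of_ae_deriv_le_max {w : ℝ → ℝ} (ht : t₀ ≤ t₁) (hκ : 0 < κ) (hΓ : 0 ≤ Γ)
    (hw : AbsolutelyContinuousOnInterval w t₀ t₁) (hg : AbsolutelyContinuousOnInterval g t₀ t₁)
    (hwd : ∀ᵐ t ∂volume.restrict (Icc t₀ t₁), deriv w t ≤ -κ * w t)
    (hgd : ∀ᵐ t ∂volume.restrict (Icc t₀ t₁), deriv g t ≤ Γ * max (w t) 0) :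
    g t₁ ≤ g t₀ + Γ / κ * max (w t₀) 0 := by
  have hmax : AbsolutelyContinuousOnInterval (fun t => max (w t) 0) t₀ t₁ :=
    absolutelyContinuousOnInterval_comp (LocallyLipschitz.id.max_const 0) hw
  have hle : g t₁ + Γ / κ * max (w t₁) 0 ≤ g t₀ + Γ / κ * max (w t₀) 0 := by
    refine le_of_ae_deriv_nonpos (f := fun t => g t + Γ / κ * max (w t) 0) ht
      (hg.fun_add (hmax.const_mul _)) ?_
    filter_upwards [hwd, hgd, ae_restrict_Icc_differentiableAt ht hw,
      ae_restrict_Icc_differentiableAt ht hg, ae_restrict_Icc_differentiableAt ht hmax]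
      with t hwt hgt dw dg dmax
    rw [(dg.hasDerivAt.fun_add (dmax.hasDerivAt.const_mul (Γ / κ))).deriv]
    calc deriv g t + Γ / κ * deriv (fun t => max (w t) 0) t
        ≤ Γ * max (w t) 0 + Γ / κ * (-κ * max (w t) 0) := by
          gcongr
          exact deriv_max_zero_le dw.continuousAt hwt
      _ = 0 := by field
  have : 0 ≤ Γ / κ * max (w t₁) 0 := by positivity
  linarith

theorem adaptiveGain_le (hT : 0 ≤ T) (hκ : 0 < κ) (hΓ : 0 ≤ Γ) (hε : 0 < ε) (hg₀ : 0 < g 0)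
    (hC₀ : 0 ≤ C) (hW : AbsolutelyContinuousOnInterval W 0 T)
    (hg : AbsolutelyContinuousOnInterval g 0 T) (hC : ∀ t ∈ Icc 0 T, W t ≤ C)
    (hWd : ∀ᵐ t ∂volume.restrict (Icc 0 T), deriv W t ≤ -κ * W t + b / g t)
    (hgd : ∀ᵐ t ∂volume.restrict (Icc 0 T), deriv g t = Γ * max (W t - ε) 0) :
    g T ≤ max (g 0) (b / (κ * ε)) + Γ / κ * C := by
  have hIcc : uIcc 0 T = Icc 0 T := uIcc_of_le hT
  have hmono : MonotoneOn g (Icc 0 T) := monotoneOn_of_ae_deriv_nonneg ordConnected_Icc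
    (fun a ha c hc => hg.mono (hIcc ▸ uIcc_subset_Icc ha hc))
    (hgd.mono fun t h => h ▸ by positivity)
  set G := max (g 0) (b / (κ * ε))
  have hG₀ : 0 < G := lt_max_of_lt_left hg₀
  by_cases hG : g T ≤ G
  · exact hG.trans (le_add_of_nonneg_right (by positivity))
  obtain ⟨t₁, ht₁, hgt₁⟩ := intermediate_value_Icc hT (hIcc ▸ hg.continuousOn)
    (show G ∈ Icc _ _ from ⟨le_max_left _ _, (not_le.1 hG).le⟩)
  -- From `t₁` on, the gain is so large that `W - ε` decays exponentially.
  have hsub : Icc t₁ T ⊆ Icc 0 T := Icc_subset_Icc ht₁.1 le_rfl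
  have htail := le_add_of_ae_deriv_le_max (w := fun t => W t - ε) (g := g) ht₁.2 hκ hΓ
    (absolutelyContinuousOnInterval_of_dist_le (C := 1)
      (hW.mono (uIcc_subset_uIcc_right (Icc_subset_uIcc ht₁))) fun x _ y _ => by simp)
    (hg.mono (uIcc_subset_uIcc_right (Icc_subset_uIcc ht₁))) (by
      filter_upwards [ae_restrict_of_ae_restrict_of_subset hsub hWd,
        ae_restrict_mem measurableSet_Icc] with t hdt ht
      have hgt : G ≤ g t := hgt₁ ▸ hmono ht₁ (hsub ht) ht.1
      have hbg : b / g t ≤ κ * ε := by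
        rw [div_le_iff₀ (hG₀.trans_le hgt)]
        have := (le_max_right (g 0) _).trans hgt
        rwa [div_le_iff₀' (by positivity)] at this
      rw [deriv_sub_const]
      linarith)
    ((ae_restrict_of_ae_restrict_of_subset hsub hgd).mono fun t h => h.le)
  have hC₁ : max (W t₁ - ε) 0 ≤ C := max_le (by linarith [hC t₁ ht₁]) hC₀
  rw [hgt₁] at htail
  exact htail.trans (by gcongr)

variable {E : Type*} [NormedAddCommGroup E] [NormedSpace ℝ E] {𝒱 : E → Set E} {K : Set E}

theorem isBoundedAlong_adaptiveGain (hK : IsCompact K) {W z : E → ℝ} (hW : LocallyLipschitz W)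
    (hz : LocallyLipschitz z) (hκ : 0 < κ) (hΓ : 0 ≤ Γ) (hε : 0 < ε)
    (hWd : ∀ s t, FollowsAt 𝒱 K s t →
      deriv (fun τ => W (s τ)) t ≤ -κ * W (s t) + b / Real.exp (z (s t)))
    (hzd : ∀ s t, FollowsAt 𝒱 K s t → HasDerivAt (fun τ => z (s τ))
      (Γ * Real.exp (-z (s t)) * max (W (s t) - ε) 0) t)
    (hWO : IsBoundedAlong 𝒱 K W) :
    IsBoundedAlong 𝒱 K z := by
  obtain ⟨C, hC⟩ := isBigO_one_principal_iff.1 hWO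
  obtain ⟨c, hc⟩ := hK.exists_bound_of_continuousOn hz.continuous.continuousOn
  refine isBigO_one_principal_iff.2
    ⟨max c (max (Real.exp c) (b / (κ * ε)) + Γ / κ * |C|), ?_⟩
  rintro _ ⟨T, s, hs, rfl⟩
  have hz₀ := abs_le.1 (hc _ hs.init)
  have hmono : MonotoneOn (fun t => z (s t)) (Icc 0 T) :=
    monotoneOn_of_ae_deriv_nonneg ordConnected_Icc
      (fun a ha d hd => (hs.absCont_comp hz).mono
        (uIcc_subset_uIcc (Icc_subset_uIcc ha) (Icc_subset_uIcc hd)))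
      (hs.ae_followsAt.mono fun t h => (hzd s t h).deriv ▸ by positivity)
  have hgain := adaptiveGain_le (g := fun t => Real.exp (z (s t))) (C := |C|) hs.nonneg hκ hΓ hε
    (Real.exp_pos _) (abs_nonneg C) (hs.absCont_comp hW)
    (hs.absCont_comp (V := fun x => Real.exp (z x)) (locallyLipschitz_exp hz))
    (fun t ht => (le_abs_self _).trans ((hC _ ⟨t, s, hs.restrict ht, rfl⟩).trans (le_abs_self C)))
    (hs.ae_followsAt.mono fun t h => hWd s t h)
    (hs.ae_followsAt.mono fun t h => by
      rw [(hzd s t h).exp.deriv, Real.exp_neg]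
      field)
  refine abs_le.2 ⟨?_, le_max_of_le_right ?_⟩
  · exact (neg_le_neg (le_max_left _ _)).trans (hz₀.1.trans
      (hmono (left_mem_Icc.2 hs.nonneg) (right_mem_Icc.2 hs.nonneg) hs.nonneg))
  · calc z (s T) ≤ Real.exp (z (s T)) := by linarith [Real.add_one_le_exp (z (s T))]
      _ ≤ max (Real.exp (z (s 0))) (b / (κ * ε)) + Γ / κ * |C| := hgain
      _ ≤ max (Real.exp c) (b / (κ * ε)) + Γ / κ * |C| := by gcongr; exact hz₀.2

theorem isBoundedAlong_energy_and_adaptiveGain (hK : IsCompact K) {W z : E → ℝ}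
    (hW : LocallyLipschitz W) (hz : LocallyLipschitz z) (hW₀ : ∀ x, 0 ≤ W x) (hκ : 0 < κ)
    (hb : 0 ≤ b) (hΓ : 0 ≤ Γ) (hε : 0 < ε)
    (hWd : ∀ s t, FollowsAt 𝒱 K s t →
      deriv (fun τ => W (s τ)) t ≤ -κ * W (s t) + b / (1 + Real.exp (z (s t))))
    (hzd : ∀ s t, FollowsAt 𝒱 K s t → HasDerivAt (fun τ => z (s τ))
      (Γ * Real.exp (-z (s t)) * max (W (s t) - ε) 0) t) :
    IsBoundedAlong 𝒱 K W ∧ IsBoundedAlong 𝒱 K z := by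
  have hWO : IsBoundedAlong 𝒱 K W :=
    isBoundedAlong_of_deriv_le (b := b) hK hW hW₀ hκ fun s t h => (hWd s t h).trans <| by
      gcongr
      exact div_le_self hb (le_add_of_nonneg_right (Real.exp_nonneg _))
  refine ⟨hWO, isBoundedAlong_adaptiveGain (b := b) hK hW hz hκ hΓ hε
    (fun s t h => (hWd s t h).trans ?_) hzd hWO⟩
  gcongr
  exact le_add_of_nonneg_left zero_le_one

end AdaptiveGain

section BoundsAndLimits

theorem exists_continuous_forall_norm_le {α E : Type*} [TopologicalSpace α] [NormalSpace α]
    [ParacompactSpace α] [Norm E] {R : α → Set E}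
    (hR : ∀ a, ∃ C : ℝ, ∀ᶠ a' in 𝓝 a, ∀ x ∈ R a', ‖x‖ ≤ C) :
    ∃ B : α → ℝ≥0, Continuous B ∧ ∀ a, ∀ x ∈ R a, ‖x‖ ≤ B a := by
  have hupper : ∀ a, IsUpperSet {C : ℝ | ∀ x ∈ R a, ‖x‖ ≤ C} := fun a C C' hC h x hx =>
    (h x hx).trans hC
  obtain ⟨g, hg⟩ := exists_continuous_forall_mem_convex_of_local_const
    (fun a => (hupper a).ordConnected.convex) hR
  exact ⟨fun a => (g a).toNNReal, continuous_real_toNNReal.comp g.continuous,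
    fun a x hx => (hg a x hx).trans (Real.le_coe_toNNReal _)⟩

theorem exists_tendsto_of_monotoneOn_Ici {z : ℝ → ℝ} {b : ℝ} (hz : MonotoneOn z (Ici 0))
    (hb : ∀ t, 0 ≤ t → z t ≤ b) :
    ∃ l, Tendsto z atTop (𝓝 l) ∧ (∀ t, 0 ≤ t → z 0 ≤ z t ∧ z t ≤ l) ∧ l ≤ b := by
  have hmono : Monotone fun t => z (max t 0) := fun a c hac =>
    hz (mem_Ici.2 (le_max_right _ _)) (mem_Ici.2 (le_max_right _ _)) (max_le_max hac le_rfl)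
  have hbdd : BddAbove (range fun t => z (max t 0)) :=
    ⟨b, forall_mem_range.2 fun t => hb _ (le_max_right _ _)⟩
  refine ⟨⨆ t, z (max t 0), (tendsto_atTop_ciSup hmono hbdd).congr' ?_,
    fun t ht => ⟨hz self_mem_Ici ht ht, ?_⟩, ciSup_le fun t => hb _ (le_max_right _ _)⟩
  · filter_upwards [eventually_ge_atTop 0] with t ht
    rw [max_eq_left ht]
  · simpa only [max_eq_left ht] using le_ciSup hbdd t

end BoundsAndLimits

namespace GFM

section Saturation

variable {M : EReal}

theorem sat_zero (hM : 0 ≤ M) : sat M 0 = 0 := by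
  simp [sat, hM.not_gt]

theorem sat_coe {M : ℝ} (hM : 0 ≤ M) (y : ℝ) : sat M y = max (-M) (min M y) := by
  simp only [sat, ← EReal.coe_neg, EReal.coe_lt_coe_iff, EReal.toReal_coe]
  split_ifs <;> grind

theorem lipschitzWith_sat (hM : 0 ≤ M) : LipschitzWith 1 (sat M) := by
  induction M with
  | bot => simp at hM
  | top => rw [show sat ⊤ = id from funext fun y => by simp [sat]]; exact LipschitzWith.id
  | coe M =>
    rw [show sat M = fun y => max (-M) (min M y) from funext (sat_coe (by exact_mod_cast hM))]
    exact (LipschitzWith.id.const_min M).const_max (-M)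

theorem abs_sat_le_abs (hM : 0 ≤ M) (y : ℝ) : |sat M y| ≤ |y| := by
  simpa [sat_zero hM] using (lipschitzWith_sat hM).dist_le_mul y 0

theorem abs_sat_le {M : ℝ} (hM : 0 ≤ M) (y : ℝ) : |sat M y| ≤ M := by
  rw [sat_coe hM, abs_le]
  exact ⟨le_max_left _ _, max_le (by linarith) (min_le_left _ _)⟩

@[fun_prop]
theorem locallyLipschitz_sat (hM : 0 ≤ M) {α : Type*} [PseudoMetricSpace α] {f : α → ℝ}
    (hf : LocallyLipschitz f) : LocallyLipschitz fun x => sat M (f x) :=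
  (lipschitzWith_sat hM).locallyLipschitz.comp hf

end Saturation

/-- The conditions on the design parameters under which the closed loop is bounded: the power
filters may be underdamped and the adaptation gains may vanish. -/
structure DesignParams.Stabilizing (D : DesignParams) : Prop where
  KVC : 0 < D.KVC
  KCC : 0 < D.KCC
  μd : 0 < D.μd
  μq : 0 < D.μq
  Γd : 0 ≤ D.Γd
  Γq : 0 ≤ D.Γq
  ε : 0 < D.ε
  ωpc : 0 < D.ωpc
  ωqc : 0 < D.ωqc
  Qbar : 0 ≤ D.Qbar
  Pbar : 0 ≤ D.Pbar
  ξp : 0 < D.ξp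
  ξq : 0 < D.ξq

theorem DesignParams.Admissible.stabilizing {D : DesignParams} (h : D.Admissible) :
    D.Stabilizing where
  KVC := h.KVC
  KCC := h.KCC
  μd := h.μd
  μq := h.μq
  Γd := h.Γd.le
  Γq := h.Γq.le
  ε := h.ε
  ωpc := h.ωpc
  ωqc := h.ωqc
  Qbar := h.Qbar.le
  Pbar := h.Pbar.le
  ξp := one_pos.trans h.ξp
  ξq := one_pos.trans h.ξq

/-- The conditions on the physical parameters under which the closed loop is bounded: the grid
side is dissipative and the filter constants, which the control law cancels, are invertible. -/
structure PhysParams.Regular (Ω : PhysParams) : Prop where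
  ωb : 0 < Ω.ωb
  Cf : Ω.Cf ≠ 0
  Lf : Ω.Lf ≠ 0
  L : 0 < Ω.L
  R : 0 < Ω.R

theorem PhysParams.Pos.regular {Ω : PhysParams} (h : Ω.Pos) : Ω.Regular where
  ωb := h.ωb
  Cf := h.Cf.ne'
  Lf := h.Lf.ne'
  L := h.L
  R := h.R

section Regularity

variable {Ω : PhysParams} {D : DesignParams}

theorem locallyLipschitz_coord (i : Fin 10) : LocallyLipschitz fun s : State => s.1 i :=
  ((EuclideanSpace.proj i : X →L[ℝ] ℝ).comp (.fst ℝ X (ℝ × ℝ))).lipschitz.locallyLipschitz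

@[fun_prop]
theorem locallyLipschitz_vcd : LocallyLipschitz fun s : State => vcd s.1 :=
  locallyLipschitz_coord 0

@[fun_prop]
theorem locallyLipschitz_vcq : LocallyLipschitz fun s : State => vcq s.1 :=
  locallyLipschitz_coord 1

@[fun_prop]
theorem locallyLipschitz_itd : LocallyLipschitz fun s : State => itd s.1 :=
  locallyLipschitz_coord 2

@[fun_prop]
theorem locallyLipschitz_itq : LocallyLipschitz fun s : State => itq s.1 :=
  locallyLipschitz_coord 3

@[fun_prop]
theorem locallyLipschitz_igd : LocallyLipschitz fun s : State => igd s.1 :=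
  locallyLipschitz_coord 4

@[fun_prop]
theorem locallyLipschitz_igq : LocallyLipschitz fun s : State => igq s.1 :=
  locallyLipschitz_coord 5

@[fun_prop]
theorem locallyLipschitz_q₁ : LocallyLipschitz fun s : State => q₁ s.1 :=
  locallyLipschitz_coord 6

@[fun_prop]
theorem locallyLipschitz_q₂ : LocallyLipschitz fun s : State => q₂ s.1 :=
  locallyLipschitz_coord 7

@[fun_prop]
theorem locallyLipschitz_p₁ : LocallyLipschitz fun s : State => p₁ s.1 :=
  locallyLipschitz_coord 8

@[fun_prop]
theorem locallyLipschitz_p₂ : LocallyLipschitz fun s : State => p₂ s.1 :=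
  locallyLipschitz_coord 9

@[fun_prop]
theorem locallyLipschitz_zd : LocallyLipschitz fun s : State => s.2.1 :=
  (LipschitzWith.prod_fst.comp LipschitzWith.prod_snd).locallyLipschitz

@[fun_prop]
theorem locallyLipschitz_zq : LocallyLipschitz fun s : State => s.2.2 :=
  (LipschitzWith.prod_snd.comp LipschitzWith.prod_snd).locallyLipschitz

@[fun_prop]
theorem locallyLipschitz_freq : LocallyLipschitz fun s : State => freq D s.1 := by
  unfold freq
  fun_prop

@[fun_prop]
theorem locallyLipschitz_vcdRef : LocallyLipschitz fun s : State => vcdRef D s.1 := by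
  unfold vcdRef
  fun_prop

@[fun_prop]
theorem locallyLipschitz_itdRef : LocallyLipschitz fun s : State => itdRef Ω D s.1 := by
  unfold itdRef
  fun_prop

@[fun_prop]
theorem locallyLipschitz_itqRef : LocallyLipschitz fun s : State => itqRef Ω D s.1 := by
  unfold itqRef
  fun_prop

@[fun_prop]
theorem locallyLipschitz_Wd : LocallyLipschitz fun s : State => Wd Ω D s.1 := by
  unfold Wd
  fun_prop

@[fun_prop]
theorem locallyLipschitz_Wq : LocallyLipschitz fun s : State => Wq Ω D s.1 := by
  unfold Wq
  fun_prop

@[fun_prop]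
theorem locallyLipschitz_sat_reactPower (hD : D.Stabilizing) :
    LocallyLipschitz fun s : State => sat D.Qbar (reactPower s.1) := by
  refine locallyLipschitz_sat (EReal.coe_nonneg.2 hD.Qbar) ?_
  unfold reactPower
  fun_prop

@[fun_prop]
theorem locallyLipschitz_sat_actPower (hD : D.Stabilizing) :
    LocallyLipschitz fun s : State => sat D.Pbar (actPower s.1) := by
  refine locallyLipschitz_sat hD.Pbar ?_
  unfold actPower
  fun_prop

@[fun_prop]
theorem locallyLipschitz_vtd (hD : D.Stabilizing) :
    LocallyLipschitz fun s : State => vtd Ω D s.1 s.2.1 := by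
  unfold vtd ud
  simp only [div_eq_mul_inv]
  fun_prop

@[fun_prop]
theorem locallyLipschitz_vtq : LocallyLipschitz fun s : State => vtq Ω D s.1 s.2.2 := by
  unfold vtq uq
  simp only [div_eq_mul_inv]
  fun_prop

theorem locallyLipschitz_closedLoop (hD : D.Stabilizing) (vgd vgq : ℝ) :
    LocallyLipschitz (closedLoop Ω D vgd vgq) := by
  refine .prodMk ?_ (by fun_prop)
  refine (PiLp.lipschitzWith_toLp 2 _).locallyLipschitz.comp (locallyLipschitz_pi fun i => ?_)
  fin_cases i <;>
    simp only [Fin.reduceFinMk, Fin.zero_eta, Fin.mk_one, Matrix.cons_val] <;>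
    fun_prop

end Regularity

section GridInput

/-- The contribution of the grid voltages to the closed loop, which is additive. -/
noncomputable def gridInput (Ω : PhysParams) (vgd vgq : ℝ) : State :=
  (WithLp.toLp 2 ![0, 0, 0, 0, -(Ω.ωb / Ω.L * vgd), -(Ω.ωb / Ω.L * vgq), 0, 0, 0, 0], 0, 0)

variable {Ω : PhysParams} {D : DesignParams} {vgd vgq : ℝ → ℝ} {s₀ : State} {I : Set ℝ}
  {s : ℝ → State}

theorem closedLoop_eq_add_gridInput (vgd vgq : ℝ) (x : State) :
    closedLoop Ω D vgd vgq x = closedLoop Ω D 0 0 x + gridInput Ω vgd vgq := by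
  refine Prod.ext ?_ (by simp [closedLoop, gridInput])
  ext i
  fin_cases i <;> simp [closedLoop, gridInput, plant] <;> ring

theorem gridInput_eq_add_smul (vgd vgq : ℝ) :
    gridInput Ω vgd vgq = vgd • gridInput Ω 1 0 + vgq • gridInput Ω 0 1 := by
  refine Prod.ext ?_ (by simp [gridInput])
  ext i
  fin_cases i <;> simp [gridInput, mul_comm]

theorem locallyIntegrableOn_gridInput (hd : MemLp vgd ⊤ halfLine) (hq : MemLp vgq ⊤ halfLine) :
    LocallyIntegrableOn (fun t => gridInput Ω (vgd t) (vgq t)) (Ici 0) := by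
  have hmem : MemLp (fun t => gridInput Ω (vgd t) (vgq t)) ⊤ (volume.restrict (Ici 0)) := by
    simp only [gridInput_eq_add_smul (vgd _)]
    exact ((ContinuousLinearMap.toSpanSingleton ℝ (gridInput Ω 1 0)).comp_memLp' hd).add
      ((ContinuousLinearMap.toSpanSingleton ℝ (gridInput Ω 0 1)).comp_memLp' hq)
  exact locallyIntegrableOn_of_locallyIntegrable_restrict (hmem.locallyIntegrable le_top)

theorem isSolutionOn_iff : IsSolutionOn Ω D vgd vgq s₀ I s ↔ s 0 = s₀ ∧
    IsCaratheodorySolutionOn (closedLoop Ω D 0 0) (fun t => gridInput Ω (vgd t) (vgq t)) I s := by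
  constructor
  · rintro ⟨h₀, hac, hode⟩
    exact ⟨h₀, hac, by simpa only [← closedLoop_eq_add_gridInput] using hode⟩
  · rintro ⟨h₀, hac, hode⟩
    exact ⟨h₀, hac, by simpa only [← closedLoop_eq_add_gridInput] using hode⟩

theorem ae_abs_le_supNorm {v : ℝ → ℝ} (hv : MemLp v ⊤ halfLine) :
    ∀ᵐ t ∂volume.restrict (Ici 0), |v t| ≤ supNorm v := by
  have h : ∀ᵐ t ∂halfLine, ‖v t‖ₑ ≤ eLpNorm v ⊤ halfLine := by
    rw [eLpNorm_exponent_top]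
    exact ae_le_eLpNormEssSup
  filter_upwards [h] with t ht
  exact_mod_cast ENNReal.toNNReal_mono hv.eLpNorm_ne_top ht

end GridInput

section Derivatives

variable {Ω : PhysParams} {D : DesignParams} {s : ℝ → State} {t vgd vgq : ℝ}

theorem hasDerivAt_coord (h : HasDerivAt s (closedLoop Ω D vgd vgq (s t)) t) (i : Fin 10) :
    HasDerivAt (fun τ => (s τ).1 i) ((closedLoop Ω D vgd vgq (s t)).1 i) t :=
  ((EuclideanSpace.proj i : X →L[ℝ] ℝ).comp (.fst ℝ X (ℝ × ℝ))).hasFDerivAt.comp_hasDerivAt t h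

theorem hasDerivAt_vcd (h : HasDerivAt s (closedLoop Ω D vgd vgq (s t)) t) :
    HasDerivAt (fun τ => vcd (s τ).1) (Ω.ωb * freq D (s t).1 * vcq (s t).1
      + Ω.ωb / Ω.Cf * (itd (s t).1 - igd (s t).1)) t :=
  hasDerivAt_coord h 0

theorem hasDerivAt_vcq (h : HasDerivAt s (closedLoop Ω D vgd vgq (s t)) t) :
    HasDerivAt (fun τ => vcq (s τ).1) (-(Ω.ωb * freq D (s t).1 * vcd (s t).1)
      + Ω.ωb / Ω.Cf * (itq (s t).1 - igq (s t).1)) t :=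
  hasDerivAt_coord h 1

theorem hasDerivAt_itd (h : HasDerivAt s (closedLoop Ω D vgd vgq (s t)) t) :
    HasDerivAt (fun τ => itd (s τ).1) (Ω.ωb * freq D (s t).1 * itq (s t).1
      + Ω.ωb / Ω.Lf * (vtd Ω D (s t).1 (s t).2.1 - vcd (s t).1)
      - Ω.ωb * Ω.Rf / Ω.Lf * itd (s t).1) t :=
  hasDerivAt_coord h 2

theorem hasDerivAt_itq (h : HasDerivAt s (closedLoop Ω D vgd vgq (s t)) t) :
    HasDerivAt (fun τ => itq (s τ).1) (-(Ω.ωb * freq D (s t).1 * itd (s t).1)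
      + Ω.ωb / Ω.Lf * (vtq Ω D (s t).1 (s t).2.2 - vcq (s t).1)
      - Ω.ωb * Ω.Rf / Ω.Lf * itq (s t).1) t :=
  hasDerivAt_coord h 3

theorem hasDerivAt_igd (h : HasDerivAt s (closedLoop Ω D vgd vgq (s t)) t) :
    HasDerivAt (fun τ => igd (s τ).1) (Ω.ωb * freq D (s t).1 * igq (s t).1
      + Ω.ωb / Ω.L * (vcd (s t).1 - vgd) - Ω.ωb * Ω.R / Ω.L * igd (s t).1) t :=
  hasDerivAt_coord h 4

theorem hasDerivAt_igq (h : HasDerivAt s (closedLoop Ω D vgd vgq (s t)) t) :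
    HasDerivAt (fun τ => igq (s τ).1) (-(Ω.ωb * freq D (s t).1 * igd (s t).1)
      + Ω.ωb / Ω.L * (vcq (s t).1 - vgq) - Ω.ωb * Ω.R / Ω.L * igq (s t).1) t :=
  hasDerivAt_coord h 5

theorem hasDerivAt_q₁ (h : HasDerivAt s (closedLoop Ω D vgd vgq (s t)) t) :
    HasDerivAt (fun τ => q₁ (s τ).1) (q₂ (s t).1) t :=
  hasDerivAt_coord h 6

theorem hasDerivAt_q₂ (h : HasDerivAt s (closedLoop Ω D vgd vgq (s t)) t) :
    HasDerivAt (fun τ => q₂ (s τ).1) (-(2 * D.ξq * D.ωqc * q₂ (s t).1)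
      - D.ωqc ^ 2 * (q₁ (s t).1 - sat D.Qbar (reactPower (s t).1))) t :=
  hasDerivAt_coord h 7

theorem hasDerivAt_p₁ (h : HasDerivAt s (closedLoop Ω D vgd vgq (s t)) t) :
    HasDerivAt (fun τ => p₁ (s τ).1) (p₂ (s t).1) t :=
  hasDerivAt_coord h 8

theorem hasDerivAt_p₂ (h : HasDerivAt s (closedLoop Ω D vgd vgq (s t)) t) :
    HasDerivAt (fun τ => p₂ (s τ).1) (-(2 * D.ξp * D.ωpc * p₂ (s t).1)
      - D.ωpc ^ 2 * (p₁ (s t).1 - sat D.Pbar (actPower (s t).1))) t :=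
  hasDerivAt_coord h 9

theorem hasDerivAt_zd (h : HasDerivAt s (closedLoop Ω D vgd vgq (s t)) t) :
    HasDerivAt (fun τ => (s τ).2.1)
      (D.Γd * Real.exp (-(s t).2.1) * max (Wd Ω D (s t).1 - D.ε) 0) t :=
  ((ContinuousLinearMap.fst ℝ ℝ ℝ).comp (.snd ℝ X (ℝ × ℝ))).hasFDerivAt.comp_hasDerivAt t h

theorem hasDerivAt_zq (h : HasDerivAt s (closedLoop Ω D vgd vgq (s t)) t) :
    HasDerivAt (fun τ => (s τ).2.2)
      (D.Γq * Real.exp (-(s t).2.2) * max (Wq Ω D (s t).1 - D.ε) 0) t :=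
  ((ContinuousLinearMap.snd ℝ ℝ ℝ).comp (.snd ℝ X (ℝ × ℝ))).hasFDerivAt.comp_hasDerivAt t h

theorem hasDerivAt_freq (h : HasDerivAt s (closedLoop Ω D vgd vgq (s t)) t) :
    HasDerivAt (fun τ => freq D (s τ).1) (-(D.KP * p₂ (s t).1)) t :=
  ((((hasDerivAt_p₁ h).const_sub D.P₀).const_mul D.KP).const_add D.ω₀).congr_deriv (by ring)

theorem hasDerivAt_vcdRef (h : HasDerivAt s (closedLoop Ω D vgd vgq (s t)) t) :
    HasDerivAt (fun τ => vcdRef D (s τ).1) (-(D.KQ * q₂ (s t).1)) t :=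
  ((((hasDerivAt_q₁ h).const_sub D.Q₀).const_mul D.KQ).const_add D.V₀).congr_deriv (by ring)

theorem hasDerivAt_vcd_sub_vcdRef (hΩ : Ω.Regular)
    (h : HasDerivAt s (closedLoop Ω D vgd vgq (s t)) t) :
    HasDerivAt (fun τ => vcd (s τ).1 - vcdRef D (s τ).1)
      (Ω.ωb / Ω.Cf * (itd (s t).1 - itdRef Ω D (s t).1)
        - D.KVC * (vcd (s t).1 - vcdRef D (s t).1)) t := by
  refine ((hasDerivAt_vcd h).fun_sub (hasDerivAt_vcdRef h)).congr_deriv ?_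
  have := hΩ.ωb.ne'
  have := hΩ.Cf
  simp only [itdRef]
  field

theorem hasDerivAt_vcq_eq_itq_sub_itqRef (hΩ : Ω.Regular)
    (h : HasDerivAt s (closedLoop Ω D vgd vgq (s t)) t) :
    HasDerivAt (fun τ => vcq (s τ).1)
      (Ω.ωb / Ω.Cf * (itq (s t).1 - itqRef Ω D (s t).1) - D.KVC * vcq (s t).1) t := by
  refine (hasDerivAt_vcq h).congr_deriv ?_
  have := hΩ.ωb.ne'
  have := hΩ.Cf
  simp only [itqRef]
  field

theorem hasDerivAt_itd_sub_itdRef (hΩ : Ω.Regular)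
    (h : HasDerivAt s (closedLoop Ω D vgd vgq (s t)) t) :
    HasDerivAt (fun τ => itd (s τ).1 - itdRef Ω D (s τ).1)
      (ud Ω D (s t).1 (s t).2.1
        + Ω.ωb / Ω.L * (vgd - vcd (s t).1 + Ω.R * igd (s t).1)) t := by
  have href := (((hasDerivAt_igd h).fun_sub
    (((hasDerivAt_freq h).const_mul Ω.Cf).fun_mul (hasDerivAt_vcq h))).fun_sub
    ((hasDerivAt_q₂ h).const_mul (Ω.Cf * D.KQ / Ω.ωb))).fun_sub
    ((hasDerivAt_vcd_sub_vcdRef hΩ h).const_mul (Ω.Cf * D.KVC / Ω.ωb))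
  refine ((hasDerivAt_itd h).fun_sub href).congr_deriv ?_
  have := hΩ.ωb.ne'
  have := hΩ.Cf
  have := hΩ.Lf
  simp only [vtd]
  generalize ud Ω D (s t).1 (s t).2.1 = u, itdRef Ω D (s t).1 = r,
    sat D.Qbar (reactPower (s t).1) = σ
  field

theorem hasDerivAt_itq_sub_itqRef (hΩ : Ω.Regular)
    (h : HasDerivAt s (closedLoop Ω D vgd vgq (s t)) t) :
    HasDerivAt (fun τ => itq (s τ).1 - itqRef Ω D (s τ).1)
      (uq Ω D (s t).1 (s t).2.2
        + Ω.ωb / Ω.L * (vgq - vcq (s t).1 + Ω.R * igq (s t).1)) t := by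
  have href := ((hasDerivAt_igq h).fun_add
    (((hasDerivAt_freq h).const_mul Ω.Cf).fun_mul (hasDerivAt_vcd h))).fun_sub
    ((hasDerivAt_vcq_eq_itq_sub_itqRef hΩ h).const_mul (Ω.Cf * D.KVC / Ω.ωb))
  refine ((hasDerivAt_itq h).fun_sub href).congr_deriv ?_
  have := hΩ.ωb.ne'
  have := hΩ.Cf
  have := hΩ.Lf
  simp only [vtq]
  generalize uq Ω D (s t).1 (s t).2.2 = u, itqRef Ω D (s t).1 = r
  field

end Derivatives

section Dissipation

theorem sq_sub_add_mul_le {v M : ℝ} (hv : |v| ≤ M) (R vc ig : ℝ) :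
    (v - vc + R * ig) ^ 2 ≤ (1 + R ^ 2 + M ^ 2) * (1 + ig ^ 2 + vc ^ 2) := by
  have hvM : v ^ 2 ≤ M ^ 2 := sq_le_sq.2 (hv.trans (le_abs_self M))
  calc (v - vc + R * ig) ^ 2 ≤ (1 + R ^ 2 + v ^ 2) * (1 + ig ^ 2 + vc ^ 2) := by
        nlinarith [sq_nonneg (v * vc + 1), sq_nonneg (v * ig - R), sq_nonneg (ig + R * vc)]
    _ ≤ (1 + R ^ 2 + M ^ 2) * (1 + ig ^ 2 + vc ^ 2) := by gcongr

-- The high-gain term of the control law absorbs the unmatched grid voltage `v` through Young's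
-- inequality.
theorem energy_dissipation_le {ωb c L R KVC KCC μ κ G e e' vc ig v M : ℝ} (hμ : 0 < μ)
    (hG : 0 < G) (hV : κ ≤ KVC) (hC : κ ≤ KCC) (hv : |v| ≤ M) :
    e * (c * e' - KVC * e)
      + e' * (-(KCC + G * ωb ^ 2 / (4 * μ) * (1 + ig ^ 2 + vc ^ 2)) * e' - c * e
        + ωb / L * (v - vc + R * ig))
      ≤ -(2 * κ) * (1 / 2 * e ^ 2 + 1 / 2 * e' ^ 2)
        + μ * ((1 + R ^ 2 + M ^ 2) / L ^ 2) / G := by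
  set N := 1 + ig ^ 2 + vc ^ 2
  have hN : 0 < N := by positivity
  set y := v - vc + R * ig
  have hy : y ^ 2 ≤ (1 + R ^ 2 + M ^ 2) * N := sq_sub_add_mul_le hv R vc ig
  have hyoung : (ωb * e') * (y / L)
      ≤ G * ωb ^ 2 / (4 * μ) * N * e' ^ 2 + μ * ((1 + R ^ 2 + M ^ 2) / L ^ 2) / G :=
    calc (ωb * e') * (y / L)
        ≤ G / (4 * μ) * N * (ωb * e') ^ 2 + (y / L) ^ 2 / (4 * (G / (4 * μ) * N)) :=
          mul_le_mul_sq_add_sq_div (by positivity) _ _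
      _ = G * ωb ^ 2 / (4 * μ) * N * e' ^ 2 + μ * (y ^ 2 / N / L ^ 2) / G := by
          rw [div_pow]; field
      _ ≤ G * ωb ^ 2 / (4 * μ) * N * e' ^ 2 + μ * ((1 + R ^ 2 + M ^ 2) / L ^ 2) / G := by
          gcongr
          rwa [div_le_iff₀ hN]
  have hgrid : e' * (ωb / L * y) = (ωb * e') * (y / L) := by ring
  nlinarith [mul_nonneg (sub_nonneg.2 hV) (sq_nonneg e),
    mul_nonneg (sub_nonneg.2 hC) (sq_nonneg e')]

variable {Ω : PhysParams} {D : DesignParams} {s : ℝ → State} {t vgd vgq M : ℝ}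

theorem deriv_Wd_le (hD : D.Stabilizing) (hΩ : Ω.Regular) (hM : |vgd| ≤ M)
    (h : HasDerivAt s (closedLoop Ω D vgd vgq (s t)) t) :
    deriv (fun τ => Wd Ω D (s τ).1) t ≤ -(2 * min D.KVC D.KCC) * Wd Ω D (s t).1
      + D.μd * ((1 + Ω.R ^ 2 + M ^ 2) / Ω.L ^ 2) / (1 + Real.exp (s t).2.1) := by
  have hderiv := (((hasDerivAt_vcd_sub_vcdRef hΩ h).fun_pow 2).const_mul (1 / 2)).fun_add
    (((hasDerivAt_itd_sub_itdRef hΩ h).fun_pow 2).const_mul (1 / 2))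
  refine hderiv.deriv.trans_le (le_trans (le_of_eq ?_) (energy_dissipation_le (ωb := Ω.ωb)
    (c := Ω.ωb / Ω.Cf) (vc := vcd (s t).1) (ig := igd (s t).1) hD.μd (by positivity)
    (min_le_left _ _) (min_le_right _ _) hM))
  simp only [ud]
  ring

theorem deriv_Wq_le (hD : D.Stabilizing) (hΩ : Ω.Regular) (hM : |vgq| ≤ M)
    (h : HasDerivAt s (closedLoop Ω D vgd vgq (s t)) t) :
    deriv (fun τ => Wq Ω D (s τ).1) t ≤ -(2 * min D.KVC D.KCC) * Wq Ω D (s t).1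
      + D.μq * ((1 + Ω.R ^ 2 + M ^ 2) / Ω.L ^ 2) / (1 + Real.exp (s t).2.2) := by
  have hderiv := (((hasDerivAt_vcq_eq_itq_sub_itqRef hΩ h).fun_pow 2).const_mul (1 / 2)).fun_add
    (((hasDerivAt_itq_sub_itqRef hΩ h).fun_pow 2).const_mul (1 / 2))
  refine hderiv.deriv.trans_le (le_trans (le_of_eq ?_) (energy_dissipation_le (ωb := Ω.ωb)
    (c := Ω.ωb / Ω.Cf) (vc := vcq (s t).1) (ig := igq (s t).1) hD.μq (by positivity)
    (min_le_left _ _) (min_le_right _ _) hM))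
  simp only [uq]
  ring

/-- The magnetic energy of the grid filter, up to the constant factor `L`. -/
noncomputable def gridEnergy (x : X) : ℝ := 1 / 2 * (igd x ^ 2 + igq x ^ 2)

theorem deriv_gridEnergy_le (hΩ : Ω.Regular) {Vd Vq : ℝ} (hVd : |vcd (s t).1 - vgd| ≤ Vd)
    (hVq : |vcq (s t).1 - vgq| ≤ Vq) (h : HasDerivAt s (closedLoop Ω D vgd vgq (s t)) t) :
    deriv (fun τ => gridEnergy (s τ).1) t ≤ -(Ω.ωb * Ω.R / Ω.L) * gridEnergy (s t).1
      + Ω.ωb / Ω.L * (Vd ^ 2 / (2 * Ω.R) + Vq ^ 2 / (2 * Ω.R)) := by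
  have hyoung : ∀ {w V : ℝ} (i : ℝ), |w| ≤ V → i * w ≤ Ω.R / 2 * i ^ 2 + V ^ 2 / (2 * Ω.R) := by
    intro w V i hw
    refine (mul_le_mul_sq_add_sq_div (half_pos hΩ.R) i w).trans ?_
    rw [show 4 * (Ω.R / 2) = 2 * Ω.R by ring]
    have := hΩ.R
    gcongr _ + ?_ / _
    exact sq_le_sq.2 (hw.trans (le_abs_self V))
  have hderiv := (((hasDerivAt_igd h).fun_pow 2).fun_add
    ((hasDerivAt_igq h).fun_pow 2)).const_mul (1 / 2)
  have hpower := mul_le_mul_of_nonneg_left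
    (add_le_add (hyoung (igd (s t).1) hVd) (hyoung (igq (s t).1) hVq))
    (div_nonneg hΩ.ωb.le hΩ.L.le)
  refine hderiv.deriv.trans_le ?_
  simp only [gridEnergy, Nat.cast_ofNat]
  linear_combination hpower

end Dissipation

/-- The velocities of the closed loop at a state, for all grid voltages of size at most `M`. -/
def velocities (Ω : PhysParams) (D : DesignParams) (M : ℝ) (x : State) : Set State :=
  {v | ∃ vgd vgq : ℝ, |vgd| ≤ M ∧ |vgq| ≤ M ∧ v = closedLoop Ω D vgd vgq x}

section Boundedness

open Asymptotics

variable {Ω : PhysParams} {D : DesignParams} {M t : ℝ} {K : Set State} {s : ℝ → State}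

theorem velocities_mono {M' : ℝ} (h : M ≤ M') (x : State) :
    velocities Ω D M x ⊆ velocities Ω D M' x :=
  fun _ ⟨vgd, vgq, hd, hq, hv⟩ => ⟨vgd, vgq, hd.trans h, hq.trans h, hv⟩

theorem exists_hasDerivAt_closedLoop (h : FollowsAt (velocities Ω D M) K s t) :
    ∃ vgd vgq : ℝ, |vgd| ≤ M ∧ |vgq| ≤ M ∧ HasDerivAt s (closedLoop Ω D vgd vgq (s t)) t := by
  obtain ⟨-, _, ⟨vgd, vgq, hd, hq, rfl⟩, hderiv⟩ := h
  exact ⟨vgd, vgq, hd, hq, hderiv⟩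

theorem isBoundedAlong_Wd_and_zd (hD : D.Stabilizing) (hΩ : Ω.Regular) (hK : IsCompact K) :
    IsBoundedAlong (velocities Ω D M) K (fun x => Wd Ω D x.1) ∧
      IsBoundedAlong (velocities Ω D M) K (fun x => x.2.1) := by
  have hμ := hD.μd
  refine isBoundedAlong_energy_and_adaptiveGain hK (by fun_prop) (by fun_prop)
    (fun x => by unfold Wd; positivity) (mul_pos two_pos (lt_min hD.KVC hD.KCC))
    (b := D.μd * ((1 + Ω.R ^ 2 + M ^ 2) / Ω.L ^ 2)) (by positivity) hD.Γd hD.ε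
    (fun s t h => ?_) (fun s t h => ?_) <;>
  obtain ⟨_, _, hd, -, hderiv⟩ := exists_hasDerivAt_closedLoop h
  exacts [deriv_Wd_le hD hΩ hd hderiv, hasDerivAt_zd hderiv]

theorem isBoundedAlong_Wq_and_zq (hD : D.Stabilizing) (hΩ : Ω.Regular) (hK : IsCompact K) :
    IsBoundedAlong (velocities Ω D M) K (fun x => Wq Ω D x.1) ∧
      IsBoundedAlong (velocities Ω D M) K (fun x => x.2.2) := by
  have hμ := hD.μq
  refine isBoundedAlong_energy_and_adaptiveGain hK (by fun_prop) (by fun_prop)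
    (fun x => by unfold Wq; positivity) (mul_pos two_pos (lt_min hD.KVC hD.KCC))
    (b := D.μq * ((1 + Ω.R ^ 2 + M ^ 2) / Ω.L ^ 2)) (by positivity) hD.Γq hD.ε
    (fun s t h => ?_) (fun s t h => ?_) <;>
  obtain ⟨_, _, -, hq, hderiv⟩ := exists_hasDerivAt_closedLoop h
  exacts [deriv_Wq_le hD hΩ hq hderiv, hasDerivAt_zq hderiv]

theorem isBoundedAlong_vcd_sub_vcdRef (hD : D.Stabilizing) (hΩ : Ω.Regular) (hK : IsCompact K) :
    IsBoundedAlong (velocities Ω D M) K (fun x => vcd x.1 - vcdRef D x.1) :=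
  isBigO_one_of_sq_le (c := 2) (isBoundedAlong_Wd_and_zd hD hΩ hK).1 fun x => by
    simp only [Wd]
    linarith [sq_nonneg (itd x.1 - itdRef Ω D x.1)]

theorem isBoundedAlong_itd_sub_itdRef (hD : D.Stabilizing) (hΩ : Ω.Regular) (hK : IsCompact K) :
    IsBoundedAlong (velocities Ω D M) K (fun x => itd x.1 - itdRef Ω D x.1) :=
  isBigO_one_of_sq_le (c := 2) (isBoundedAlong_Wd_and_zd hD hΩ hK).1 fun x => by
    simp only [Wd]
    linarith [sq_nonneg (vcd x.1 - vcdRef D x.1)]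

theorem isBoundedAlong_vcq (hD : D.Stabilizing) (hΩ : Ω.Regular) (hK : IsCompact K) :
    IsBoundedAlong (velocities Ω D M) K (fun x => vcq x.1) :=
  isBigO_one_of_sq_le (c := 2) (isBoundedAlong_Wq_and_zq hD hΩ hK).1 fun x => by
    simp only [Wq]
    linarith [sq_nonneg (itq x.1 - itqRef Ω D x.1)]

theorem isBoundedAlong_itq_sub_itqRef (hD : D.Stabilizing) (hΩ : Ω.Regular) (hK : IsCompact K) :
    IsBoundedAlong (velocities Ω D M) K (fun x => itq x.1 - itqRef Ω D x.1) :=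
  isBigO_one_of_sq_le (c := 2) (isBoundedAlong_Wq_and_zq hD hΩ hK).1 fun x => by
    simp only [Wq]
    linarith [sq_nonneg (vcq x.1)]

theorem isBoundedAlong_q₁_and_q₂ (hD : D.Stabilizing) (hK : IsCompact K) :
    IsBoundedAlong (velocities Ω D M) K (fun x => q₁ x.1) ∧
      IsBoundedAlong (velocities Ω D M) K (fun x => q₂ x.1) := by
  refine isBoundedAlong_secondOrderFilter hK (u := fun x => sat D.Qbar (reactPower x.1))
    (by fun_prop) (by fun_prop) hD.ξq hD.ωqc (fun s t h => ?_) (fun s t h => ?_)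
    (isBigO_one_principal_iff.2 ⟨D.Qbar, fun x _ => abs_sat_le hD.Qbar _⟩) <;>
  obtain ⟨_, _, -, -, hderiv⟩ := exists_hasDerivAt_closedLoop h
  exacts [hasDerivAt_q₁ hderiv, hasDerivAt_q₂ hderiv]

theorem isBoundedAlong_vcd (hD : D.Stabilizing) (hΩ : Ω.Regular) (hK : IsCompact K) :
    IsBoundedAlong (velocities Ω D M) K (fun x => vcd x.1) := by
  have hvcdRef : IsBoundedAlong (velocities Ω D M) K (fun x => vcdRef D x.1) :=
    (isBigO_one_const D.V₀).add
      (((isBigO_one_const D.Q₀).sub (isBoundedAlong_q₁_and_q₂ hD hK).1).const_mul_left D.KQ)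
  simpa using (isBoundedAlong_vcd_sub_vcdRef hD hΩ hK).add hvcdRef

theorem isBoundedAlong_gridEnergy (hD : D.Stabilizing) (hΩ : Ω.Regular) (hK : IsCompact K) :
    IsBoundedAlong (velocities Ω D M) K (fun x => gridEnergy x.1) := by
  obtain ⟨Vd, hVd⟩ := isBigO_one_principal_iff.1 (isBoundedAlong_vcd (M := M) hD hΩ hK)
  obtain ⟨Vq, hVq⟩ := isBigO_one_principal_iff.1 (isBoundedAlong_vcq (M := M) hD hΩ hK)
  refine isBoundedAlong_of_deriv_le hK
    (b := Ω.ωb / Ω.L * ((Vd + M) ^ 2 / (2 * Ω.R) + (Vq + M) ^ 2 / (2 * Ω.R)))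
    (by unfold gridEnergy; fun_prop) (fun x => by unfold gridEnergy; positivity)
    (div_pos (mul_pos hΩ.ωb hΩ.R) hΩ.L) fun s t h => ?_
  obtain ⟨_, _, hd, hq, hderiv⟩ := exists_hasDerivAt_closedLoop h
  exact deriv_gridEnergy_le hΩ ((abs_sub _ _).trans (add_le_add (hVd _ h.1) hd))
    ((abs_sub _ _).trans (add_le_add (hVq _ h.1) hq)) hderiv

theorem isBoundedAlong_igd (hD : D.Stabilizing) (hΩ : Ω.Regular) (hK : IsCompact K) :
    IsBoundedAlong (velocities Ω D M) K (fun x => igd x.1) :=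
  isBigO_one_of_sq_le (c := 2) (isBoundedAlong_gridEnergy hD hΩ hK) fun x => by
    simp only [gridEnergy]
    linarith [sq_nonneg (igq x.1)]

theorem isBoundedAlong_igq (hD : D.Stabilizing) (hΩ : Ω.Regular) (hK : IsCompact K) :
    IsBoundedAlong (velocities Ω D M) K (fun x => igq x.1) :=
  isBigO_one_of_sq_le (c := 2) (isBoundedAlong_gridEnergy hD hΩ hK) fun x => by
    simp only [gridEnergy]
    linarith [sq_nonneg (igd x.1)]

theorem isBoundedAlong_p₁_and_p₂ (hD : D.Stabilizing) (hΩ : Ω.Regular) (hK : IsCompact K) :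
    IsBoundedAlong (velocities Ω D M) K (fun x => p₁ x.1) ∧
      IsBoundedAlong (velocities Ω D M) K (fun x => p₂ x.1) := by
  have hpower : IsBoundedAlong (velocities Ω D M) K (fun x => actPower x.1) :=
    (isBigO_one_mul (isBoundedAlong_vcd hD hΩ hK) (isBoundedAlong_igd hD hΩ hK)).add
      (isBigO_one_mul (isBoundedAlong_vcq hD hΩ hK) (isBoundedAlong_igq hD hΩ hK))
  refine isBoundedAlong_secondOrderFilter hK (u := fun x => sat D.Pbar (actPower x.1))
    (by fun_prop) (by fun_prop) hD.ξp hD.ωpc (fun s t h => ?_) (fun s t h => ?_)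
    ((isBigO_of_le _ fun x => abs_sat_le_abs hD.Pbar _).trans hpower) <;>
  obtain ⟨_, _, -, -, hderiv⟩ := exists_hasDerivAt_closedLoop h
  exacts [hasDerivAt_p₁ hderiv, hasDerivAt_p₂ hderiv]

theorem isBoundedAlong_freq (hD : D.Stabilizing) (hΩ : Ω.Regular) (hK : IsCompact K) :
    IsBoundedAlong (velocities Ω D M) K (fun x => freq D x.1) :=
  (isBigO_one_const D.ω₀).add
    (((isBigO_one_const D.P₀).sub (isBoundedAlong_p₁_and_p₂ hD hΩ hK).1).const_mul_left D.KP)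

theorem isBoundedAlong_itd (hD : D.Stabilizing) (hΩ : Ω.Regular) (hK : IsCompact K) :
    IsBoundedAlong (velocities Ω D M) K (fun x => itd x.1) := by
  have hitdRef : IsBoundedAlong (velocities Ω D M) K (fun x => itdRef Ω D x.1) :=
    (((isBoundedAlong_igd hD hΩ hK).sub
      (isBigO_one_mul ((isBoundedAlong_freq hD hΩ hK).const_mul_left Ω.Cf)
        (isBoundedAlong_vcq hD hΩ hK))).sub
      ((isBoundedAlong_q₁_and_q₂ hD hK).2.const_mul_left _)).sub
      ((isBoundedAlong_vcd_sub_vcdRef hD hΩ hK).const_mul_left _)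
  simpa using (isBoundedAlong_itd_sub_itdRef hD hΩ hK).add hitdRef

theorem isBoundedAlong_itq (hD : D.Stabilizing) (hΩ : Ω.Regular) (hK : IsCompact K) :
    IsBoundedAlong (velocities Ω D M) K (fun x => itq x.1) := by
  have hitqRef : IsBoundedAlong (velocities Ω D M) K (fun x => itqRef Ω D x.1) :=
    ((isBoundedAlong_igq hD hΩ hK).add
      (isBigO_one_mul ((isBoundedAlong_freq hD hΩ hK).const_mul_left Ω.Cf)
        (isBoundedAlong_vcd hD hΩ hK))).sub
      ((isBoundedAlong_vcq hD hΩ hK).const_mul_left _)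
  simpa using (isBoundedAlong_itq_sub_itqRef hD hΩ hK).add hitqRef

theorem isBoundedAlong_fst (hD : D.Stabilizing) (hΩ : Ω.Regular) (hK : IsCompact K) :
    IsBoundedAlong (velocities Ω D M) K (fun x => x.1) := by
  have hcoord : IsBoundedAlong (velocities Ω D M) K (fun x => WithLp.ofLp x.1) := by
    refine isBigO_pi.2 fun i => ?_
    have hq := isBoundedAlong_q₁_and_q₂ (Ω := Ω) (M := M) hD hK
    have hp := isBoundedAlong_p₁_and_p₂ (M := M) hD hΩ hK
    fin_cases i
    exacts [isBoundedAlong_vcd hD hΩ hK, isBoundedAlong_vcq hD hΩ hK, isBoundedAlong_itd hD hΩ hK,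
      isBoundedAlong_itq hD hΩ hK, isBoundedAlong_igd hD hΩ hK, isBoundedAlong_igq hD hΩ hK,
      hq.1, hq.2, hp.1, hp.2]
  exact ((EuclideanSpace.equiv (Fin 10) ℝ).symm.isBigO_comp _ _).trans hcoord

theorem exists_norm_le_of_mem_reachableSet (hD : D.Stabilizing) (hΩ : Ω.Regular)
    (hK : IsCompact K) (M : ℝ) : ∃ C, ∀ x ∈ reachableSet (velocities Ω D M) K, ‖x‖ ≤ C :=
  isBigO_one_principal_iff.1 <| (isBoundedAlong_fst hD hΩ hK).prod_left <|
    (isBoundedAlong_Wd_and_zd hD hΩ hK).2.prod_left (isBoundedAlong_Wq_and_zq hD hΩ hK).2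

end Boundedness

section Solutions

variable {Ω : PhysParams} {D : DesignParams} {vgd vgq : ℝ → ℝ} {s₀ : State} {I J : Set ℝ} {t T : ℝ}
  {s s' : ℝ → State}

theorem exists_continuous_norm_le_of_mem_reachableSet (hD : D.Stabilizing) (hΩ : Ω.Regular) :
    ∃ B : X × ℝ × ℝ × ℝ≥0 × ℝ≥0 → ℝ≥0, Continuous B ∧ ∀ d,
      ∀ x ∈ reachableSet (velocities Ω D (max d.2.2.2.1 d.2.2.2.2)) {(d.1, d.2.1, d.2.2.1)},
      ‖x‖ ≤ B d := by
  refine exists_continuous_forall_norm_le fun d => ?_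
  let M : X × ℝ × ℝ × ℝ≥0 × ℝ≥0 → ℝ := fun d => max d.2.2.2.1 d.2.2.2.2
  let init : X × ℝ × ℝ × ℝ≥0 × ℝ≥0 → State := fun d => (d.1, d.2.1, d.2.2.1)
  have hM : Continuous M := by fun_prop
  have hinit : Continuous init := by fun_prop
  obtain ⟨C, hC⟩ := exists_norm_le_of_mem_reachableSet hD hΩ
    (isCompact_closedBall (init d) 1) (M d + 1)
  refine ⟨C, ?_⟩
  filter_upwards [hM.continuousAt.eventually_le_const (lt_add_one (M d)),
    hinit.continuousAt (Metric.closedBall_mem_nhds _ one_pos)] with d' hMd' hd' x hx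
  exact hC x (reachableSet_mono (velocities_mono hMd') (singleton_subset_iff.2 hd') hx)

namespace IsSolutionOn

theorem mono (h : IsSolutionOn Ω D vgd vgq s₀ I s) (hJ : J ⊆ I) :
    IsSolutionOn Ω D vgd vgq s₀ J s :=
  isSolutionOn_iff.2 ((isSolutionOn_iff.1 h).imp_right fun h => h.mono hJ)

theorem apply_eq (hD : D.Stabilizing) (ht : 0 ≤ t) (h : IsSolutionOn Ω D vgd vgq s₀ I s)
    (h' : IsSolutionOn Ω D vgd vgq s₀ J s') (hI : Icc 0 t ⊆ I) (hJ : Icc 0 t ⊆ J) :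
    s t = s' t :=
  IsCaratheodorySolutionOn.apply_right_eq (locallyLipschitz_closedLoop hD 0 0) ht
    (isSolutionOn_iff.1 (h.mono hI)).2 (isSolutionOn_iff.1 (h'.mono hJ)).2
    (h.init.trans h'.init.symm)

theorem mem_reachableSet (hd : MemLp vgd ⊤ halfLine) (hq : MemLp vgq ⊤ halfLine) (hT : 0 ≤ T)
    (h : IsSolutionOn Ω D vgd vgq s₀ (Icc 0 T) s) :
    s T ∈ reachableSet (velocities Ω D (max (supNorm vgd) (supNorm vgq))) {s₀} := by
  refine ⟨T, s, ⟨hT, h.init, h.absCont 0 (left_mem_Icc.2 hT) T (right_mem_Icc.2 hT), ?_⟩, rfl⟩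
  filter_upwards [h.ode,
    ae_restrict_of_ae_restrict_of_subset Icc_subset_Ici_self (ae_abs_le_supNorm hd),
    ae_restrict_of_ae_restrict_of_subset Icc_subset_Ici_self (ae_abs_le_supNorm hq)]
    with t hode hdt hqt
  exact ⟨_, ⟨vgd t, vgq t, hdt.trans (le_max_left _ _), hqt.trans (le_max_right _ _), rfl⟩, hode⟩

theorem monotoneOn_zd (hΓ : 0 ≤ D.Γd) (hI : I.OrdConnected)
    (h : IsSolutionOn Ω D vgd vgq s₀ I s) : MonotoneOn (fun t => (s t).2.1) I := by
  refine monotoneOn_of_ae_deriv_nonneg hI (fun a ha b hb => absolutelyContinuousOnInterval_comp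
    (g := fun x : State => x.2.1) locallyLipschitz_zd (h.absCont a ha b hb)) ?_
  filter_upwards [h.ode] with t hode
  rw [(hasDerivAt_zd hode).deriv]
  positivity

theorem monotoneOn_zq (hΓ : 0 ≤ D.Γq) (hI : I.OrdConnected)
    (h : IsSolutionOn Ω D vgd vgq s₀ I s) : MonotoneOn (fun t => (s t).2.2) I := by
  refine monotoneOn_of_ae_deriv_nonneg hI (fun a ha b hb => absolutelyContinuousOnInterval_comp
    (g := fun x : State => x.2.2) locallyLipschitz_zq (h.absCont a ha b hb)) ?_
  filter_upwards [h.ode] with t hode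
  rw [(hasDerivAt_zq hode).deriv]
  positivity

end IsSolutionOn

theorem exists_isSolutionOn_Ici (hD : D.Stabilizing) (hΩ : Ω.Regular)
    (hd : MemLp vgd ⊤ halfLine) (hq : MemLp vgq ⊤ halfLine) (s₀ : State) :
    ∃ s, IsSolutionOn Ω D vgd vgq s₀ (Ici 0) s := by
  obtain ⟨C, hC⟩ := exists_norm_le_of_mem_reachableSet hD hΩ (isCompact_singleton (x := s₀))
    (max (supNorm vgd) (supNorm vgq))
  obtain ⟨s, hs⟩ := exists_isCaratheodorySolutionOn_Ici (locallyLipschitz_closedLoop hD 0 0)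
    (locallyIntegrableOn_gridInput hd hq) fun T hT s h₀ h =>
      hC _ ((isSolutionOn_iff.2 ⟨h₀, h⟩).mem_reachableSet hd hq hT)
  exact ⟨s, isSolutionOn_iff.2 hs⟩

end Solutions

end GFM

theorem theorem1_general (D : GFM.DesignParams) (hD : D.Stabilizing)
    (Ω : GFM.PhysParams) (hΩ : Ω.Regular) :
    ∃ B : GFM.X × ℝ × ℝ × ℝ≥0 × ℝ≥0 → ℝ≥0, Continuous B ∧
      ∀ vgd vgq : ℝ → ℝ, MemLp vgd ⊤ GFM.halfLine → MemLp vgq ⊤ GFM.halfLine →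
      ∀ (x₀ : GFM.X) (zd₀ zq₀ : ℝ),
      ∃ (x : ℝ → GFM.X) (zd zq : ℝ → ℝ),
        GFM.IsSolutionOn Ω D vgd vgq (x₀, zd₀, zq₀) (Ici 0) (fun t => (x t, zd t, zq t)) ∧
        (∀ s : ℝ → GFM.State, GFM.IsSolutionOn Ω D vgd vgq (x₀, zd₀, zq₀) (Ici 0) s →
          ∀ t, 0 ≤ t → s t = (x t, zd t, zq t)) ∧
        (∀ T : ℝ, 0 < T → ∀ s : ℝ → GFM.State,
          GFM.IsSolutionOn Ω D vgd vgq (x₀, zd₀, zq₀) (Ico 0 T) s →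
          ∀ t ∈ Ico 0 T, s t = (x t, zd t, zq t)) ∧
        (∀ t, 0 ≤ t → ‖x t‖ ≤ B (x₀, zd₀, zq₀, GFM.supNorm vgd, GFM.supNorm vgq)) ∧
        MonotoneOn zd (Ici 0) ∧ MonotoneOn zq (Ici 0) ∧
        ∃ zdInf zqInf : ℝ,
          Tendsto zd atTop (𝓝 zdInf) ∧ Tendsto zq atTop (𝓝 zqInf) ∧
          (∀ t, 0 ≤ t → zd₀ ≤ zd t ∧ zd t ≤ zdInf) ∧
          (∀ t, 0 ≤ t → zq₀ ≤ zq t ∧ zq t ≤ zqInf) ∧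
          zdInf ≤ B (x₀, zd₀, zq₀, GFM.supNorm vgd, GFM.supNorm vgq) ∧
          zqInf ≤ B (x₀, zd₀, zq₀, GFM.supNorm vgd, GFM.supNorm vgq) := by
  obtain ⟨B, hB, hBR⟩ := GFM.exists_continuous_norm_le_of_mem_reachableSet hD hΩ
  refine ⟨B, hB, fun vgd vgq hd hq x₀ zd₀ zq₀ => ?_⟩
  obtain ⟨s, hs⟩ := GFM.exists_isSolutionOn_Ici hD hΩ hd hq (x₀, zd₀, zq₀)
  have hnorm : ∀ t, 0 ≤ t → ‖s t‖ ≤ B (x₀, zd₀, zq₀, GFM.supNorm vgd, GFM.supNorm vgq) :=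
    fun t ht => hBR _ _ ((hs.mono Icc_subset_Ici_self).mem_reachableSet hd hq ht)
  have hmd := hs.monotoneOn_zd hD.Γd ordConnected_Ici
  have hmq := hs.monotoneOn_zq hD.Γq ordConnected_Ici
  obtain ⟨zdInf, hld, hzd, hdB⟩ := exists_tendsto_of_monotoneOn_Ici hmd fun t ht =>
    (le_abs_self _).trans ((norm_fst_le (s t).2).trans ((norm_snd_le (s t)).trans (hnorm t ht)))
  obtain ⟨zqInf, hlq, hzq, hqB⟩ := exists_tendsto_of_monotoneOn_Ici hmq fun t ht =>
    (le_abs_self _).trans ((norm_snd_le (s t).2).trans ((norm_snd_le (s t)).trans (hnorm t ht)))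
  rw [hs.init] at hzd hzq
  exact ⟨fun t => (s t).1, fun t => (s t).2.1, fun t => (s t).2.2, hs,
    fun _ h t ht => h.apply_eq hD ht hs Icc_subset_Ici_self Icc_subset_Ici_self,
    fun _ _ _ h t ht => h.apply_eq hD ht.1 hs (Icc_subset_Ico_right ht.2) Icc_subset_Ici_self,
    fun t ht => (norm_fst_le (s t)).trans (hnorm t ht), hmd, hmq, zdInf, zqInf, hld, hlq,
    hzd, hzq, hdB, hqB⟩

theorem theorem1 (D : GFM.DesignParams) (hD : D.Admissible)
    (Ω : GFM.PhysParams) (hΩ : Ω.Pos) :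
    ∃ B : GFM.X × ℝ × ℝ × ℝ≥0 × ℝ≥0 → ℝ≥0, Continuous B ∧
      ∀ vgd vgq : ℝ → ℝ, MemLp vgd ⊤ GFM.halfLine → MemLp vgq ⊤ GFM.halfLine →
      ∀ (x₀ : GFM.X) (zd₀ zq₀ : ℝ),
      ∃ (x : ℝ → GFM.X) (zd zq : ℝ → ℝ),
        GFM.IsSolutionOn Ω D vgd vgq (x₀, zd₀, zq₀) (Ici 0) (fun t => (x t, zd t, zq t)) ∧
        (∀ s : ℝ → GFM.State, GFM.IsSolutionOn Ω D vgd vgq (x₀, zd₀, zq₀) (Ici 0) s →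
          ∀ t, 0 ≤ t → s t = (x t, zd t, zq t)) ∧
        (∀ T : ℝ, 0 < T → ∀ s : ℝ → GFM.State,
          GFM.IsSolutionOn Ω D vgd vgq (x₀, zd₀, zq₀) (Ico 0 T) s →
          ∀ t ∈ Ico 0 T, s t = (x t, zd t, zq t)) ∧
        (∀ t, 0 ≤ t → ‖x t‖ ≤ B (x₀, zd₀, zq₀, GFM.supNorm vgd, GFM.supNorm vgq)) ∧
        MonotoneOn zd (Ici 0) ∧ MonotoneOn zq (Ici 0) ∧
        ∃ zdInf zqInf : ℝ,
          Tendsto zd atTop (𝓝 zdInf) ∧ Tendsto zq atTop (𝓝 zqInf) ∧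
          (∀ t, 0 ≤ t → zd₀ ≤ zd t ∧ zd t ≤ zdInf) ∧
          (∀ t, 0 ≤ t → zq₀ ≤ zq t ∧ zq t ≤ zqInf) ∧
          zdInf ≤ B (x₀, zd₀, zq₀, GFM.supNorm vgd, GFM.supNorm vgq) ∧
          zqInf ≤ B (x₀, zd₀, zq₀, GFM.supNorm vgd, GFM.supNorm vgq) :=
  theorem1_general D hD.stabilizing Ω hΩ.regular
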